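/- Let $\mathcal K\subset\mathbb R^m$ be a closed convex polyhedral cone and let $\mathcal X\subset\mathbb R^n$ be a nonempty polyhedral set. Consider $$\min\{f(x):\ x\in\mathcal X_{\rm feas}\},\qquad \mathcal X_{\rm feas}=\{x\in\mathcal X:\ h(x)=0,\ g(x)\in-\mathcal K\},$$ with $f:\mathbb R^n\to\mathbb R$, $h:\mathbb R^n\to\mathbb R^p$, $g:\mathbb R^n\to\mathbb R^m$. Notation. $\|\cdot\|$ and $\operatorname{dist}$ are Euclidean. $\nabla h(x),\nabla g(x)$ are Jacobians. For a closed convex set $C$, $\mathcal T_C(x)$ is the tangent cone and $\mathcal N_C(x)=\{s:\langle s,x'-x\rangle\le0\ \forall x'\in C\}$ the normal cone of $C$ at $x\in C$. For a set $C$, $C^*=\{y:\langle y,x\rangle\ge 0\ \forall x\in C\}$. Let $\Phi(x,v,\lambda)=f(x)+\langle v,h(x)\rangle+\langle\lambda,g(x)\rangle$ and, for $x\in\mathcal X$, $$\mathcal M(x)=\{(v,\lambda)\in\mathbb R^p\times\mathcal K^*:\ -\nabla_x\Phi(x,v,\lambda)\in\mathcal N_{\mathcal X}(x),\ \langle\lambda,g(x)\rangle=0\}.$$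 A point $x$ is a KKT point if $x\in\mathcal X_{\rm feas}$ and $\mathcal M(x)\neq\emptyset$. For $x\in\mathcal X$, $v\in\mathbb R^p$, $\lambda\in\mathcal K^*$ put $$r(x,v,\lambda)=\operatorname{dist}\bigl(0,\nabla_x\Phi(x,v,\lambda)+\mathcal N_{\mathcal X}(x)\bigr)+\|h(x)\|+\operatorname{dist}\bigl(0,-g(x)+\mathcal N_{\mathcal K^*}(\lambda)\bigr).$$ Let $\bar x$ be a KKT point such that $f,g,h$ are twice continuously differentiable near $\bar x$, and suppose that the conic MFCQ relative to $\mathcal X$ holds at $\bar x$: (i) if $\nabla h(\bar x)^\top v+s=0$ with $v\in\mathbb R^p$ and $s\in\mathcal N_{\mathcal X}(\bar x)$, then $v=0$ and $s=0$; (ii) there is $d\in\mathcal T_{\mathcal X}(\bar x)$ with $\nabla h(\bar x)d=0$ and $g(\bar x)+\nabla g(\bar x)d\in-\operatorname{int}(\mathcal K)$. Then $\mathcal M(\bar x)$ is bounded. Let further $$\mathcal C=\{d\in\mathcal T_{\mathcal X}(\bar x):\ \nabla h(\bar x)d=0,\ \nabla g(\bar x)d\in\mathcal T_{-\mathcal K}(g(\bar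 x)),\ \langle\nabla f(\bar x),d\rangle=0\}$$ be the critical cone, and assume in addition that for every $(v,\lambda)\in\mathcal M(\bar x)$ the system $$d\in\mathcal C,\qquad \nabla^2_{xx}\Phi(\bar x,v,\lambda)d\in\mathcal C^*,\qquad \langle d,\nabla^2_{xx}\Phi(\bar x,v,\lambda)d\rangle=0$$ has only the trivial solution $d=0$. Then $\bar x$ is an isolated KKT point, i.e. some neighbourhood of $\bar x$ contains no other KKT point, and there exist constants $c>0$ and $\varepsilon>0$ such that for all $x\in\mathcal X$, $v\in\mathbb R^p$, $\lambda\in\mathcal K^*$, $$\|x-\bar x\|+\operatorname{dist}((v,\lambda),\mathcal M(\bar x))\le\varepsilon\ \Longrightarrow\ \|x-\bar x\|+\operatorname{dist}((v,\lambda),\mathcal M(\bar x))\le c\,r(x,v,\lambda).$$ -/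

import Mathlib

open scoped Pointwise Topology

noncomputable section

/-- A polyhedral set: the solution set of finitely many (possibly zero) non-strict linear
inequalities. -/
def IsPolyhedralSet {E : Type*} [NormedAddCommGroup E] [InnerProductSpace ℝ E] (S : Set E) : Prop :=
  ∃ (k : ℕ) (a : Fin k → E) (b : Fin k → ℝ), S = {x | ∀ i, inner ℝ (a i) x ≤ b i}

/-- The normal cone of a convex set `C` at `x` (empty when `x ∉ C`). -/
def normalCone {E : Type*} [NormedAddCommGroup E] [InnerProductSpace ℝ E] (C : Set E) (x : E) :
    Set E :=
  {d | x ∈ C ∧ ∀ x' ∈ C, inner ℝ d (x' - x) ≤ 0}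

/-- The data of the problem `min {f x : x ∈ X, h x = 0, g x ∈ -K}`, with `n` variables, `p` equality
constraints, and a constraint with respect to a convex cone in `ℝᵐ`. -/
structure ConicProgram (n p m : ℕ) where
  /-- the domain -/
  X : Set (EuclideanSpace ℝ (Fin n))
  /-- the cone -/
  K : PointedCone ℝ (EuclideanSpace ℝ (Fin m))
  /-- the objective function -/
  f : EuclideanSpace ℝ (Fin n) → ℝ
  /-- the equality constraints -/
  h : EuclideanSpace ℝ (Fin n) → EuclideanSpace ℝ (Fin p)
  /-- the conic constraint map -/
  g : EuclideanSpace ℝ (Fin n) → EuclideanSpace ℝ (Fin m)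

namespace ConicProgram

variable {n p m : ℕ} (P : ConicProgram n p m)

/-- The space `ℝᵖ × ℝᵐ` of multipliers `(v, λ)`, with its Euclidean norm. -/
abbrev Multiplier (p m : ℕ) : Type :=
  WithLp 2 (EuclideanSpace ℝ (Fin p) × EuclideanSpace ℝ (Fin m))

/-- The feasible set. -/
def feasible : Set (EuclideanSpace ℝ (Fin n)) :=
  {x | x ∈ P.X ∧ P.h x = 0 ∧ P.g x ∈ -(P.K : Set (EuclideanSpace ℝ (Fin m)))}

/-- The dual cone `K* = {l : ⟪y, l⟫ ≥ 0 for all y ∈ K}`. -/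
def dualCone : Set (EuclideanSpace ℝ (Fin m)) :=
  (ProperCone.innerDual (P.K : Set (EuclideanSpace ℝ (Fin m))) : Set (EuclideanSpace ℝ (Fin m)))

/-- The smooth part of the Lagrangian, `Φ(x, v, λ) = f x + ⟪v, h x⟫ + ⟪λ, g x⟫`, at `y = (v, λ)`. -/
def lagrangian (x : EuclideanSpace ℝ (Fin n)) (y : Multiplier p m) : ℝ :=
  P.f x + inner ℝ y.fst (P.h x) + inner ℝ y.snd (P.g x)

/-- The partial gradient `∇ₓΦ(x, v, λ)`. -/
def gradLagrangian (x : EuclideanSpace ℝ (Fin n)) (y : Multiplier p m) :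
    EuclideanSpace ℝ (Fin n) :=
  gradient (fun x' => P.lagrangian x' y) x

/-- The partial Hessian `∇²ₓₓΦ(x, v, λ)`, as a linear operator. -/
def hessLagrangian (x : EuclideanSpace ℝ (Fin n)) (y : Multiplier p m) :
    EuclideanSpace ℝ (Fin n) →L[ℝ] EuclideanSpace ℝ (Fin n) :=
  fderiv ℝ (fun x' => P.gradLagrangian x' y) x

/-- The multiplier set `M(x)`. -/
def multipliers (x : EuclideanSpace ℝ (Fin n)) : Set (Multiplier p m) :=
  {y | y.snd ∈ P.dualCone ∧ -P.gradLagrangian x y ∈ normalCone P.X x ∧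
    inner ℝ y.snd (P.g x) = 0}

/-- A KKT point: a feasible point which has a multiplier. -/
def IsKKTPoint (x : EuclideanSpace ℝ (Fin n)) : Prop :=
  x ∈ P.feasible ∧ (P.multipliers x).Nonempty

/-- The KKT residual `r(x, v, λ)`, for `x ∈ X` and `λ ∈ K*` (both sets whose distance to `0` is
taken are nonempty for such arguments). -/
def residual (x : EuclideanSpace ℝ (Fin n)) (y : Multiplier p m) : ℝ :=
  Metric.infDist 0 ({P.gradLagrangian x y} + normalCone P.X x) + ‖P.h x‖ +
    Metric.infDist 0 ({-P.g x} + normalCone P.dualCone y.snd)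

/-- The conic Mangasarian-Fromovitz constraint qualification relative to `X`. -/
def ConicMFCQ (x : EuclideanSpace ℝ (Fin n)) : Prop :=
  (∀ (v : EuclideanSpace ℝ (Fin p)), ∀ s ∈ normalCone P.X x,
    ContinuousLinearMap.adjoint (fderiv ℝ P.h x) v + s = 0 → v = 0 ∧ s = 0) ∧
  ∃ d ∈ posTangentConeAt P.X x, fderiv ℝ P.h x d = 0 ∧
    P.g x + fderiv ℝ P.g x d ∈ -interior (P.K : Set (EuclideanSpace ℝ (Fin m)))

/-- The critical cone. -/
def criticalCone (x : EuclideanSpace ℝ (Fin n)) : Set (EuclideanSpace ℝ (Fin n)) :=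
  {d | d ∈ posTangentConeAt P.X x ∧ fderiv ℝ P.h x d = 0 ∧
    fderiv ℝ P.g x d ∈ posTangentConeAt (-(P.K : Set (EuclideanSpace ℝ (Fin m)))) (P.g x) ∧
    inner ℝ (gradient P.f x) d = 0}

/-- `d` solves the homogeneous second-order complementarity system `C ∋ d ⊥ ∇²ₓₓΦ(x, v, λ) d ∈ C*`,
where `C` is the critical cone at `x` and `y = (v, λ)`. -/
def SolvesSecondOrderSystem (x : EuclideanSpace ℝ (Fin n)) (y : Multiplier p m)
    (d : EuclideanSpace ℝ (Fin n)) : Prop :=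
  d ∈ P.criticalCone x ∧ inner ℝ d (P.hessLagrangian x y d) = 0 ∧
    P.hessLagrangian x y d ∈ ProperCone.innerDual (P.criticalCone x)

end ConicProgram

end

/-!
The assertion on boundedness is the usual consequence of the constraint qualification: a limit of
normalized multipliers at points tending to `xbar` would be a nonzero recession direction of the
multiplier set at `xbar`, and there is none (`eq_zero_of_conicMFCQ`). This gives a bound which is
uniform over all points near `xbar` (`eventually_multipliers_bounded`).

The error bound rests on polyhedrality, which enters in two ways. First, the normal cone map of a
polyhedral set is locally decreasing: `normalCone S x ⊆ normalCone S x₀` for all `x` near `x₀`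
(`IsPolyhedralSet.eventually_normalCone_subset`). It is applied to `X` and, because `K` is its own
bidual, to `-K`: a normal vector `w` of `K*` at `λ` is a point of `-K` which has `λ` as a normal
vector. Secondly, the multiplier set at `xbar` is a polyhedron, so Hoffman's bound estimates the
distance of `(v, λ)` from it by a multiple of `‖x - xbar‖ + r(x, v, λ)`
(`exists_infDist_multipliers_le`). Both Hoffman's bound and the description of normal cones of
polyhedral sets are derived from the representation of a finitely generated cone by finitely many
linear inequalities, which is proved by Fourier-Motzkin elimination.

It remains to bound `‖x - xbar‖` by the residual. If this fails, there are `xₖ → xbar` and `yₖ`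
whose residual is `o(τₖ)`, `τₖ = ‖xₖ - xbar‖`. Let `ŷₖ` be the multiplier at `xbar` nearest to `yₖ`.
By the Hoffman bound `(yₖ - ŷₖ) / τₖ` is bounded, so along a subsequence `(xₖ - xbar) / τₖ → d`,
`yₖ → ȳ` and `(yₖ - ŷₖ) / τₖ → z`. Dividing the residual relations by `τₖ` and using that the normal
cone maps are monotone and locally decreasing, one finds that the unit vector `d` solves the
second-order system at the multiplier `ȳ` (`solvesSecondOrderSystem_of_tendsto`), which is excluded.

The residual vanishes at a KKT point with any of its multipliers, and multipliers at points near
`xbar` are close to the multiplier set at `xbar`; hence `xbar` is isolated.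
-/

open Filter

/-! ### Finitely generated cones -/

section Polyhedral

/-- Weyl's theorem: a finitely generated cone is cut out by finitely many linear functionals. The
generators are added one by one, and the coefficient of the new one is eliminated from the
inequalities. -/
theorem exists_functionals_of_finset {V ι : Type*} [AddCommGroup V] [Module ℝ V]
    [FiniteDimensional ℝ V] (a : ι → V) (t : Finset ι) :
    ∃ s : Finset (V →ₗ[ℝ] ℝ), ∀ x : V,
      (∃ μ : ι → ℝ, (∀ i, 0 ≤ μ i) ∧ x = ∑ i ∈ t, μ i • a i) ↔ ∀ φ ∈ s, 0 ≤ φ x := by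
  classical
  induction t using Finset.induction_on with
  | empty =>
    let B := Module.finBasis ℝ V
    refine ⟨Finset.univ.image B.coord ∪ Finset.univ.image (fun i => -B.coord i), fun x => ?_⟩
    constructor
    · rintro ⟨μ, -, rfl⟩
      simp
    · intro hx
      refine ⟨fun _ => 0, fun _ => le_rfl, ?_⟩
      rw [Finset.sum_empty]
      refine B.ext_elem fun i => ?_
      have h1 := hx (B.coord i) (by simp)
      have h2 := hx (-B.coord i) (by simp)
      simp only [LinearMap.neg_apply, Module.Basis.coord_apply] at h1 h2
      simpa using le_antisymm (by linarith) h1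
  | insert j t hj ih =>
    obtain ⟨s, hs⟩ := ih
    have key : ∀ x : V, (∃ μ : ι → ℝ, (∀ i, 0 ≤ μ i) ∧ x = ∑ i ∈ insert j t, μ i • a i) ↔
        ∃ c : ℝ, 0 ≤ c ∧ ∀ φ ∈ s, 0 ≤ φ (x - c • a j) := by
      intro x
      constructor
      · rintro ⟨μ, hμ, rfl⟩
        refine ⟨μ j, hμ j, (hs _).1 ⟨μ, hμ, ?_⟩⟩
        rw [Finset.sum_insert hj, add_sub_cancel_left]
      · rintro ⟨c, hc, h⟩
        obtain ⟨μ, hμ, h⟩ := (hs _).2 h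
        refine ⟨Function.update μ j c, fun i => ?_, ?_⟩
        · rcases eq_or_ne i j with rfl | hi
          · simpa using hc
          · simpa [hi] using hμ i
        · rw [Finset.sum_insert hj, Function.update_self, ← sub_eq_iff_eq_add', h]
          refine Finset.sum_congr rfl fun i hi => ?_
          rw [Function.update_of_ne (by rintro rfl; exact hj hi)]
    -- Fourier-Motzkin elimination of `c`: a functional positive at `a j` bounds `c` from above, one
    -- negative at `a j` bounds it from below, and each such pair has to be compatible. Keeping the
    -- functionals positive at `a j` themselves makes the upper bounds compatible with `0 ≤ c`.
    refine ⟨s.filter (fun φ => 0 ≤ φ (a j)) ∪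
      ((s ×ˢ s).filter (fun q => 0 < q.1 (a j) ∧ q.2 (a j) < 0)).image
        (fun q => q.1 (a j) • q.2 - q.2 (a j) • q.1), fun x => ?_⟩
    rw [key]
    constructor
    · rintro ⟨c, hc, h⟩ φ hφ
      rw [Finset.mem_union, Finset.mem_image] at hφ
      simp only [map_sub, map_smul, smul_eq_mul] at h
      rcases hφ with hφ | ⟨q, hq, rfl⟩
      · rw [Finset.mem_filter] at hφ
        nlinarith [h φ hφ.1, hφ.2, mul_nonneg hc hφ.2]
      · simp only [Finset.mem_filter, Finset.mem_product] at hq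
        have h1 := h _ hq.1.1
        have h2 := h _ hq.1.2
        simp only [LinearMap.sub_apply, LinearMap.smul_apply, smul_eq_mul]
        nlinarith [mul_nonneg hq.2.1.le h2, mul_nonneg (neg_nonneg.2 hq.2.2.le) h1]
    · intro h
      let A : Finset ℝ := insert 0 ((s.filter (fun φ => φ (a j) < 0)).image fun φ => φ x / φ (a j))
      have hA : A.Nonempty := Finset.insert_nonempty _ _
      refine ⟨A.max' hA, A.le_max' _ (Finset.mem_insert_self _ _), fun φ hφ => ?_⟩
      simp only [map_sub, map_smul, smul_eq_mul, sub_nonneg]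
      rcases lt_trichotomy (φ (a j)) 0 with h0 | h0 | h0
      · have : φ x / φ (a j) ≤ A.max' hA := A.le_max' _ <| Finset.mem_insert_of_mem <|
          Finset.mem_image_of_mem _ (Finset.mem_filter.2 ⟨hφ, h0⟩)
        rwa [div_le_iff_of_neg h0] at this
      · rw [h0, mul_zero]
        exact h φ (Finset.mem_union_left _ (Finset.mem_filter.2 ⟨hφ, h0.ge⟩))
      · rw [← le_div_iff₀ h0]
        refine A.max'_le hA _ fun y hy => ?_
        rcases Finset.mem_insert.1 hy with rfl | hy
        · exact div_nonneg (h φ (Finset.mem_union_left _ (Finset.mem_filter.2 ⟨hφ, h0.le⟩))) h0.le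
        · obtain ⟨ψ, hψ, rfl⟩ := Finset.mem_image.1 hy
          rw [Finset.mem_filter] at hψ
          have := h _ (Finset.mem_union_right _ (Finset.mem_image_of_mem _ (Finset.mem_filter.2
            (⟨Finset.mem_product.2 ⟨hφ, hψ.1⟩, h0, hψ.2⟩ :
              ((φ, ψ) : (V →ₗ[ℝ] ℝ) × (V →ₗ[ℝ] ℝ)) ∈ s ×ˢ s ∧ _))))
          simp only [LinearMap.sub_apply, LinearMap.smul_apply, smul_eq_mul] at this
          rw [le_div_iff₀ h0, div_mul_eq_mul_div, div_le_iff_of_neg hψ.2]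
          linarith

/-- The coefficients of an element of a finitely generated cone can be chosen bounded by a multiple
of its norm. -/
theorem exists_bounded_coefficients {V ι : Type*} [NormedAddCommGroup V] [NormedSpace ℝ V]
    [FiniteDimensional ℝ V] (a : ι → V) (t : Finset ι) :
    ∃ C : ℝ, 0 ≤ C ∧ ∀ ν : ι → ℝ, (∀ i, 0 ≤ ν i) → ∃ μ : ι → ℝ, (∀ i, 0 ≤ μ i) ∧
      ∑ i ∈ t, ν i • a i = ∑ i ∈ t, μ i • a i ∧ ∑ i ∈ t, μ i ≤ C * ‖∑ i ∈ t, ν i • a i‖ := by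
  classical
  -- the cone of all `(u, τ)` such that `u = ∑ μ i • a i` with `μ ≥ 0` and `∑ μ i ≤ τ`
  obtain ⟨s, hs⟩ := exists_functionals_of_finset
    (fun o : Option ι => o.elim ((0 : V), (1 : ℝ)) fun i => (a i, 1)) t.insertNone
  have hs' : ∀ u τ, (∃ μ : ι → ℝ, (∀ i, 0 ≤ μ i) ∧ u = ∑ i ∈ t, μ i • a i ∧
      ∑ i ∈ t, μ i ≤ τ) ↔ ∀ φ ∈ s, 0 ≤ φ (u, τ) := by
    intro u τ
    rw [← hs]
    constructor
    · rintro ⟨μ, hμ, rfl, hτ⟩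
      refine ⟨fun o => o.elim (τ - ∑ i ∈ t, μ i) μ, fun o => ?_, ?_⟩
      · cases o
        · simpa using hτ
        · exact hμ _
      · rw [Finset.sum_insertNone]
        ext
        · simp [Prod.fst_sum]
        · simp [Prod.snd_sum]
    · rintro ⟨μ, hμ, h⟩
      rw [Finset.sum_insertNone, Prod.ext_iff] at h
      refine ⟨fun i => μ (some i), fun i => hμ _, by simpa [Prod.fst_sum] using h.1, ?_⟩
      have := h.2
      simp only [Prod.snd_add, Prod.snd_sum, Option.elim, Prod.smul_snd, smul_eq_mul,
        mul_one] at this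
      linarith [hμ none]
  -- An inequality `0 ≤ φ (u, τ)` restricts `τ` only if `φ (0, 1) > 0`, and then it holds for all
  -- `τ ≥ c φ * ‖u‖`.
  let c : ((V × ℝ) →ₗ[ℝ] ℝ) → ℝ := fun φ =>
    ‖LinearMap.toContinuousLinearMap (φ.comp (LinearMap.inl ℝ V ℝ))‖ / φ (0, 1)
  refine ⟨∑ φ ∈ s, |c φ|, Finset.sum_nonneg fun _ _ => abs_nonneg _, fun ν hν => ?_⟩
  set u := ∑ i ∈ t, ν i • a i with hu
  have split : ∀ (φ : (V × ℝ) →ₗ[ℝ] ℝ) τ, φ (u, τ) = φ (u, 0) + τ * φ (0, 1) := by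
    intro φ τ
    rw [← smul_eq_mul, ← map_smul, ← map_add]
    simp
  obtain ⟨μ, hμ, h1, h2⟩ := (hs' u ((∑ φ ∈ s, |c φ|) * ‖u‖)).2 fun φ hφ => by
    rw [split]
    have hnn : 0 ≤ φ (0, 1) := (hs' 0 1).1 ⟨0, fun _ => le_rfl, by simp, by simp⟩ φ hφ
    rcases hnn.eq_or_lt with h0 | h0
    · have := (hs' u (∑ i ∈ t, ν i)).1 ⟨ν, hν, hu, le_rfl⟩ φ hφ
      rw [split, ← h0] at this
      rw [← h0]
      simpa using this
    · have h1 := (LinearMap.toContinuousLinearMap (φ.comp (LinearMap.inl ℝ V ℝ))).le_opNorm u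
      have h2 : c φ ≤ ∑ φ ∈ s, |c φ| := (le_abs_self _).trans
        (Finset.single_le_sum (f := fun φ => |c φ|) (fun _ _ => abs_nonneg _) hφ)
      have h3 : c φ * φ (0, 1) = ‖LinearMap.toContinuousLinearMap (φ.comp (LinearMap.inl ℝ V ℝ))‖ :=
        div_mul_cancel₀ _ h0.ne'
      have h4 : c φ * ‖u‖ * φ (0, 1) ≤ (∑ φ ∈ s, |c φ|) * ‖u‖ * φ (0, 1) := by gcongr
      rw [← h3] at h1
      simp only [LinearMap.coe_toContinuousLinearMap', LinearMap.comp_apply, LinearMap.inl_apply,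
        Real.norm_eq_abs] at h1
      nlinarith [neg_abs_le (φ (u, 0))]
  exact ⟨μ, hμ, h1, h2⟩

/-! ### Polyhedral sets, their normal cones, and Hoffman's bound -/

variable {E F : Type*} [NormedAddCommGroup E] [InnerProductSpace ℝ E]
  [NormedAddCommGroup F] [InnerProductSpace ℝ F]

theorem IsPolyhedralSet.of_finite {ι : Type*} [Finite ι] {S : Set E} (a : ι → E) (b : ι → ℝ)
    (h : ∀ x, x ∈ S ↔ ∀ i, inner ℝ (a i) x ≤ b i) : IsPolyhedralSet S := by
  obtain ⟨k, ⟨e⟩⟩ := Finite.exists_equiv_fin ι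
  refine ⟨k, a ∘ e.symm, b ∘ e.symm, Set.ext fun x => (h x).trans ?_⟩
  exact ⟨fun h i => h _, fun h i => by simpa using h (e i)⟩

theorem IsPolyhedralSet.preimage [CompleteSpace E] [CompleteSpace F] {S : Set F}
    (hS : IsPolyhedralSet S) (c : F) (L : E →L[ℝ] F) :
    IsPolyhedralSet {y | c + L y ∈ S} := by
  obtain ⟨k, a, b, rfl⟩ := hS
  refine .of_finite (fun i => L.adjoint (a i)) (fun i => b i - inner ℝ (a i) c) fun y => ?_
  simp only [Set.mem_ofPred_eq, inner_add_right, ContinuousLinearMap.adjoint_inner_left,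
    le_sub_iff_add_le']

theorem IsPolyhedralSet.isClosed {S : Set E} (hS : IsPolyhedralSet S) : IsClosed S := by
  obtain ⟨k, a, b, rfl⟩ := hS
  simp only [Set.ofPred_forall]
  exact isClosed_iInter fun i => isClosed_le (by fun_prop) continuous_const

theorem IsPolyhedralSet.convex {S : Set E} (hS : IsPolyhedralSet S) : Convex ℝ S := by
  obtain ⟨k, a, b, rfl⟩ := hS
  simp only [Set.ofPred_forall]
  exact convex_iInter fun i => convex_halfSpace_le (innerₛₗ ℝ (a i)).isLinear _

/-- A direction along which a constraint does not increase if it is active is feasible for this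
constraint. -/
theorem eventually_add_smul_le {a x d : E} {b : ℝ} (hx : inner ℝ a x ≤ b)
    (hd : inner ℝ a x = b → inner ℝ a d ≤ 0) :
    ∀ᶠ t : ℝ in 𝓝[>] 0, inner ℝ a (x + t • d) ≤ b := by
  rcases hx.eq_or_lt with h | h
  · filter_upwards [self_mem_nhdsWithin] with t ht
    rw [inner_add_right, inner_smul_right, h]
    nlinarith [mul_nonneg (le_of_lt ht) (neg_nonneg.2 (hd h))]
  · have hc : Continuous fun t : ℝ => inner ℝ a (x + t • d) := by fun_prop
    have := (hc.continuousAt (x := 0)).eventually_lt continuousAt_const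
      (show inner ℝ a (x + (0 : ℝ) • d) < b by simpa using h)
    exact (this.filter_mono nhdsWithin_le_nhds).mono fun _ h => h.le

/-- Farkas' lemma: the normal cone of a polyhedral set is generated by the gradients of the active
constraints. -/
theorem mem_normalCone_iff_exists [FiniteDimensional ℝ E] {k : ℕ} {a : Fin k → E} {b : Fin k → ℝ}
    {x s : E} (hx : ∀ i, inner ℝ (a i) x ≤ b i) :
    s ∈ normalCone {x | ∀ i, inner ℝ (a i) x ≤ b i} x ↔
      ∃ μ : Fin k → ℝ, (∀ i, 0 ≤ μ i) ∧
        s = ∑ i ∈ Finset.univ.filter (fun i => inner ℝ (a i) x = b i), μ i • a i := by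
  constructor
  · intro hs
    obtain ⟨Φ, hΦ⟩ := exists_functionals_of_finset a
      (Finset.univ.filter (fun i => inner ℝ (a i) x = b i))
    refine (hΦ s).2 fun φ hφ => ?_
    -- `-d` is a feasible direction, for `φ` is nonnegative at the active gradients
    let d := (InnerProductSpace.toDual ℝ E).symm (LinearMap.toContinuousLinearMap φ)
    have hd : ∀ z, inner ℝ d z = φ z := fun z => by simp [d]
    have hd' : ∀ᶠ t : ℝ in 𝓝[>] 0, ∀ i, inner ℝ (a i) (x + t • (-d)) ≤ b i := by
      refine eventually_all.2 fun i => eventually_add_smul_le (hx i) fun hi => ?_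
      rw [inner_neg_right, real_inner_comm, hd, neg_nonpos]
      refine (hΦ (a i)).1 ⟨Pi.single i 1, fun j => ?_, ?_⟩ φ hφ
      · by_cases h : j = i <;> simp [h]
      · rw [Finset.sum_eq_single i]
        · simp
        · intro j _ hj
          simp [hj]
        · simp [hi]
    obtain ⟨t, ht, ht0⟩ := (hd'.and self_mem_nhdsWithin).exists
    have h1 := hs.2 _ ht
    rw [add_sub_cancel_left, inner_smul_right, inner_neg_right, real_inner_comm, hd] at h1
    have ht0 : 0 < t := ht0
    nlinarith
  · rintro ⟨μ, hμ, rfl⟩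
    refine ⟨hx, fun z hz => ?_⟩
    rw [sum_inner]
    refine Finset.sum_nonpos fun i hi => ?_
    rw [inner_smul_left, inner_sub_right, (Finset.mem_filter.1 hi).2]
    exact mul_nonpos_of_nonneg_of_nonpos (hμ i) (sub_nonpos.2 (hz i))

theorem IsPolyhedralSet.isPolyhedralSet_normalCone [FiniteDimensional ℝ E] {S : Set E}
    (hS : IsPolyhedralSet S) {x : E} (hx : x ∈ S) : IsPolyhedralSet (normalCone S x) := by
  obtain ⟨k, a, b, rfl⟩ := hS
  obtain ⟨Φ, hΦ⟩ := exists_functionals_of_finset a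
    (Finset.univ.filter (fun i => inner ℝ (a i) x = b i))
  refine .of_finite (ι := Φ) (fun φ => -(InnerProductSpace.toDual ℝ E).symm
    (LinearMap.toContinuousLinearMap φ.1)) (fun _ => 0) fun s => ?_
  rw [mem_normalCone_iff_exists hx, hΦ]
  simp

/-- Near `x₀` only constraints active at `x₀` are active, so a feasible direction at `x₀` is one at
all nearby points of the polyhedral set. -/
theorem IsPolyhedralSet.eventually_normalCone_subset {S : Set E} (hS : IsPolyhedralSet S)
    {x₀ : E} (hx₀ : x₀ ∈ S) : ∀ᶠ x in 𝓝 x₀, normalCone S x ⊆ normalCone S x₀ := by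
  obtain ⟨k, a, b, rfl⟩ := hS
  have h : ∀ᶠ x in 𝓝 x₀, ∀ i, inner ℝ (a i) x₀ < b i → inner ℝ (a i) x < b i := by
    refine eventually_all.2 fun i => ?_
    by_cases hi : inner ℝ (a i) x₀ < b i
    · have hc : Continuous fun x : E => inner ℝ (a i) x := by fun_prop
      exact (hc.continuousAt.eventually_lt continuousAt_const hi).mono fun _ h _ => h
    · exact Eventually.of_forall fun x h => absurd h hi
  filter_upwards [h] with x hx s hs
  refine ⟨hx₀, fun z hz => ?_⟩
  have hd : ∀ᶠ t : ℝ in 𝓝[>] 0, ∀ i, inner ℝ (a i) (x + t • (z - x₀)) ≤ b i := by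
    refine eventually_all.2 fun i => eventually_add_smul_le (hs.1 i) fun hi => ?_
    have : inner ℝ (a i) x₀ = b i := le_antisymm (hx₀ i) (not_lt.1 fun h => (hx i h).ne hi)
    rw [inner_sub_right, this, sub_nonpos]
    exact hz i
  obtain ⟨t, ht, ht0⟩ := (hd.and self_mem_nhdsWithin).exists
  have h1 := hs.2 _ ht
  rw [add_sub_cancel_left, inner_smul_right] at h1
  have ht0 : 0 < t := ht0
  nlinarith

/-- Hoffman's bound. If `p` is the projection of `x`, then `x - p` is a combination of the active
`a i` with nonnegative coefficients at most of the order of `‖x - p‖`; the inner product of `x - p`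
with this combination is at most of the order of `δ * ‖x - p‖`. -/
theorem exists_hoffman [FiniteDimensional ℝ E] {k : ℕ} {a : Fin k → E} {b : Fin k → ℝ}
    (hne : {x | ∀ i, inner ℝ (a i) x ≤ b i}.Nonempty) :
    ∃ C : ℝ, 0 ≤ C ∧ ∀ x δ, (∀ i, inner ℝ (a i) x ≤ b i + δ) →
      0 ≤ δ → Metric.infDist x {x | ∀ i, inner ℝ (a i) x ≤ b i} ≤ C * δ := by
  classical
  set S := {x | ∀ i, inner ℝ (a i) x ≤ b i} with hSdef
  have hS : IsPolyhedralSet S := ⟨k, a, b, rfl⟩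
  choose C hC0 hC using exists_bounded_coefficients a
  refine ⟨∑ t, C t, Finset.sum_nonneg fun t _ => hC0 t, fun x δ hx hδ => ?_⟩
  obtain ⟨p, hp, hxp⟩ := hS.isClosed.exists_infDist_eq_dist hne x
  have hu : x - p ∈ normalCone S p := by
    refine ⟨hp, (norm_eq_iInf_iff_real_inner_le_zero hS.convex hp).1 ?_⟩
    rw [← dist_eq_norm, ← hxp, Metric.infDist_eq_iInf]
    simp only [dist_eq_norm]
  obtain ⟨ν, hν, hsum⟩ := (mem_normalCone_iff_exists hp).1 hu
  set t := Finset.univ.filter (fun i => inner ℝ (a i) p = b i) with ht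
  obtain ⟨μ, hμ, h1, h2⟩ := hC t ν hν
  rw [← hsum] at h1 h2
  have hle : C t ≤ ∑ t, C t := Finset.single_le_sum (fun t _ => hC0 t) (Finset.mem_univ t)
  have h3 : ‖x - p‖ ^ 2 ≤ (∑ t, C t) * δ * ‖x - p‖ := by
    calc ‖x - p‖ ^ 2 = inner ℝ (∑ i ∈ t, μ i • a i) (x - p) := by
          rw [← h1, real_inner_self_eq_norm_sq]
      _ = ∑ i ∈ t, μ i * (inner ℝ (a i) x - b i) := by
          rw [sum_inner]
          refine Finset.sum_congr rfl fun i hi => ?_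
          rw [real_inner_smul_left, inner_sub_right, (Finset.mem_filter.1 hi).2]
      _ ≤ ∑ i ∈ t, μ i * δ := Finset.sum_le_sum fun i _ =>
          mul_le_mul_of_nonneg_left (by linarith [hx i]) (hμ i)
      _ = (∑ i ∈ t, μ i) * δ := by rw [Finset.sum_mul]
      _ ≤ (C t * ‖x - p‖) * δ := by gcongr
      _ ≤ ((∑ t, C t) * ‖x - p‖) * δ := by gcongr
      _ = _ := by ring
  rw [hxp, dist_eq_norm]
  rcases (norm_nonneg (x - p)).eq_or_lt with h0 | h0
  · rw [← h0]
    exact mul_nonneg (Finset.sum_nonneg fun t _ => hC0 t) hδ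
  · rw [sq] at h3
    exact le_of_mul_le_mul_right h3 h0

/-- Hoffman's bound for a system `y ∈ S`, `c + L y ∈ T` with polyhedral sets `S` and `T`. -/
theorem IsPolyhedralSet.exists_infDist_le [FiniteDimensional ℝ E] [FiniteDimensional ℝ F]
    {S : Set E} {T : Set F} (hS : IsPolyhedralSet S) (hT : IsPolyhedralSet T) (c : F)
    (L : E →L[ℝ] F) (hne : {y | y ∈ S ∧ c + L y ∈ T}.Nonempty) :
    ∃ C : ℝ, 0 ≤ C ∧ ∀ y ∈ S, ∀ z ∈ T,
      Metric.infDist y {y | y ∈ S ∧ c + L y ∈ T} ≤ C * ‖c + L y - z‖ := by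
  obtain ⟨k, a, b, rfl⟩ := hS
  obtain ⟨k', a', b', rfl⟩ := hT
  have hset : {y | y ∈ {x | ∀ i, inner ℝ (a i) x ≤ b i} ∧
      c + L y ∈ {x | ∀ i, inner ℝ (a' i) x ≤ b' i}} =
      {y | ∀ i : Fin (k + k'), inner ℝ (Fin.append a (fun i => L.adjoint (a' i)) i) y ≤
        Fin.append b (fun i => b' i - inner ℝ (a' i) c) i} := by
    ext y
    simp only [Set.mem_ofPred_eq, Fin.forall_fin_add, Fin.append_left, Fin.append_right,
      ContinuousLinearMap.adjoint_inner_left, inner_add_right, le_sub_iff_add_le']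
  rw [hset] at hne ⊢
  obtain ⟨C, hC0, hC⟩ := exists_hoffman hne
  have hB : 0 ≤ ∑ i, ‖a' i‖ := Finset.sum_nonneg fun _ _ => norm_nonneg _
  refine ⟨C * ∑ i, ‖a' i‖, by positivity, fun y hy z hz => ?_⟩
  rw [mul_assoc]
  refine hC y _ ((Fin.forall_fin_add _).2 ⟨fun i => ?_, fun i => ?_⟩) (by positivity)
  · simp only [Fin.append_left]
    have : 0 ≤ (∑ i, ‖a' i‖) * ‖c + L y - z‖ := by positivity
    linarith [hy i]
  · simp only [Fin.append_right, ContinuousLinearMap.adjoint_inner_left]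
    have h1 : inner ℝ (a' i) (c + L y - z) ≤ (∑ i, ‖a' i‖) * ‖c + L y - z‖ :=
      (real_inner_le_norm _ _).trans <| by
        gcongr
        exact Finset.single_le_sum (f := fun i => ‖a' i‖) (fun _ _ => norm_nonneg _)
          (Finset.mem_univ i)
    rw [inner_sub_right, inner_add_right] at h1
    linarith [hz i]

end Polyhedral

/-! ### Tangent and normal directions -/

section Cones

variable {E F : Type*} [NormedAddCommGroup E] [InnerProductSpace ℝ E]
  [NormedAddCommGroup F] [NormedSpace ℝ F]

theorem inner_nonpos_of_mem_posTangentConeAt {C : Set E} {x s d : E} (hs : s ∈ normalCone C x)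
    (hd : d ∈ posTangentConeAt C x) : inner ℝ s d ≤ 0 := by
  have hmax : IsLocalMaxOn (fun z => inner ℝ s z) C x := by
    filter_upwards [self_mem_nhdsWithin] with z hz
    have := hs.2 z hz
    rwa [inner_sub_right, sub_nonpos] at this
  exact hmax.hasFDerivWithinAt_nonpos (innerSL ℝ s).hasFDerivAt.hasFDerivWithinAt hd

theorem mem_posTangentConeAt_of_tendsto {α : Type*} {l : Filter α} [l.NeBot] {C : Set E} {x d : E}
    {z : α → E} {τ : α → ℝ} (hτ : ∀ k, 0 < τ k) (hτ0 : Tendsto τ l (𝓝 0)) (hz : ∀ k, z k ∈ C)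
    (hd : Tendsto (fun k => (τ k)⁻¹ • (z k - x)) l (𝓝 d)) : d ∈ posTangentConeAt C x := by
  refine mem_tangentConeAt_of_seq l (fun k => (τ k)⁻¹.toNNReal) (fun k => z k - x) ?_
    (Eventually.of_forall fun k => by simpa using hz k) ?_
  · have := hτ0.smul hd
    rw [zero_smul] at this
    exact this.congr fun k => smul_inv_smul₀ (hτ k).ne' _
  · refine hd.congr fun k => ?_
    rw [NNReal.smul_def, Real.coe_toNNReal _ (inv_nonneg.2 (hτ k).le)]

theorem HasFDerivAt.tendsto_inv_smul_sub {f : E → F} {f' : E →L[ℝ] F} {x d : E} {α : Type*}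
    {l : Filter α} (hf : HasFDerivAt f f' x) {z : α → E} {τ : α → ℝ} (hz : Tendsto z l (𝓝 x))
    (hd : Tendsto (fun k => (τ k)⁻¹ • (z k - x)) l (𝓝 d)) :
    Tendsto (fun k => (τ k)⁻¹ • (f (z k) - f x)) l (𝓝 (f' d)) := by
  have h0 : Tendsto (fun k => z k - x) l (𝓝 0) := by simpa using hz.sub_const x
  simpa using (hf.hasFDerivWithinAt (s := Set.univ)).lim h0 (by simp) hd

theorem Filter.Tendsto.clm_apply {G α : Type*} [NormedAddCommGroup G] [NormedSpace ℝ G]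
    {l : Filter α} {A : α → G →L[ℝ] F} {A₀ : G →L[ℝ] F} {v : α → G} {v₀ : G}
    (hA : Tendsto A l (𝓝 A₀)) (hv : Tendsto v l (𝓝 v₀)) :
    Tendsto (fun k => A k (v k)) l (𝓝 (A₀ v₀)) :=
  (isBoundedBilinearMap_apply.continuous.tendsto (A₀, v₀)).comp (hA.prodMk_nhds hv)

theorem zero_mem_normalCone {C : Set E} {x : E} (hx : x ∈ C) : (0 : E) ∈ normalCone C x :=
  ⟨hx, fun _ _ => by simp⟩

theorem isClosed_normalCone (C : Set E) (x : E) : IsClosed (normalCone C x) := by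
  by_cases hx : x ∈ C
  · have : normalCone C x = ⋂ z ∈ C, {d | inner ℝ d (z - x) ≤ 0} := by
      ext d
      simp [normalCone, hx]
    rw [this]
    exact isClosed_biInter fun z _ => isClosed_le (by fun_prop) continuous_const
  · have : normalCone C x = ∅ := Set.eq_empty_of_forall_notMem fun d hd => hx hd.1
    rw [this]
    exact isClosed_empty

/-- The normal cone map has closed graph. -/
theorem mem_normalCone_of_tendsto {α : Type*} {l : Filter α} [l.NeBot] {C : Set E} {x s : E}
    {z σ : α → E} (hx : x ∈ C) (hz : Tendsto z l (𝓝 x)) (hσ : Tendsto σ l (𝓝 s))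
    (h : ∀ k, σ k ∈ normalCone C (z k)) : s ∈ normalCone C x :=
  ⟨hx, fun y hy => le_of_tendsto (hσ.inner (hz.const_sub y))
    (Eventually.of_forall fun k => (h k).2 y hy)⟩

theorem smul_mem_normalCone {C : Set E} {x s : E} {c : ℝ} (hc : 0 ≤ c)
    (hs : s ∈ normalCone C x) : c • s ∈ normalCone C x :=
  ⟨hs.1, fun z hz => by
    rw [real_inner_smul_left]
    exact mul_nonpos_of_nonneg_of_nonpos hc (hs.2 z hz)⟩

theorem exists_mem_norm_add_eq_infDist [FiniteDimensional ℝ E] {S : Set E} (hS : IsClosed S)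
    (hne : S.Nonempty) (a : E) : ∃ s ∈ S, ‖a + s‖ = Metric.infDist 0 ({a} + S) := by
  have hcl : IsClosed ({a} + S) := by
    rw [Set.singleton_add]
    exact (Homeomorph.addLeft a).isClosedMap _ hS
  obtain ⟨z, hz, h⟩ := hcl.exists_infDist_eq_dist ((Set.singleton_nonempty a).add hne) 0
  rw [Set.singleton_add] at hz
  obtain ⟨s, hs, rfl⟩ := hz
  exact ⟨s, hs, by rw [h, dist_zero_left]⟩

theorem isBoundedLinearMap_adjoint {G : Type*} [NormedAddCommGroup G] [InnerProductSpace ℝ G]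
    [CompleteSpace E] [CompleteSpace G] :
    IsBoundedLinearMap ℝ (fun A : E →L[ℝ] G => ContinuousLinearMap.adjoint A) where
  map_add := map_add _
  map_smul c A := by simp
  bound := ⟨1, one_pos, fun A => by simp⟩

theorem isBoundedLinearMap_toDual_symm [CompleteSpace E] :
    IsBoundedLinearMap ℝ (fun φ : StrongDual ℝ E => (InnerProductSpace.toDual ℝ E).symm φ) where
  map_add := map_add _
  map_smul c A := by simp
  bound := ⟨1, one_pos, fun A => by simp⟩

end Cones

/-! ### The cone, its dual, and the residual -/

namespace ConicProgram

variable {n p m : ℕ} (P : ConicProgram n p m)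

theorem mem_dualCone {l : EuclideanSpace ℝ (Fin m)} :
    l ∈ P.dualCone ↔ ∀ k ∈ P.K, 0 ≤ inner ℝ l k := by
  refine ProperCone.mem_innerDual.trans ⟨fun h k hk => ?_, fun h k hk => ?_⟩
  · rw [real_inner_comm]
    exact h hk
  · rw [real_inner_comm]
    exact h k hk

theorem mem_normalCone_neg_cone {w l : EuclideanSpace ℝ (Fin m)}
    (hw : w ∈ -(P.K : Set (EuclideanSpace ℝ (Fin m)))) :
    l ∈ normalCone (-(P.K : Set (EuclideanSpace ℝ (Fin m)))) w ↔
      l ∈ P.dualCone ∧ inner ℝ l w = 0 := by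
  rw [mem_dualCone]
  have hwK : -w ∈ P.K := hw
  constructor
  · intro h
    have h1 : inner ℝ l w = 0 := by
      have h0 := h.2 0 (by simp)
      have h2 := h.2 ((2 : ℝ) • w) (by
        rw [Set.mem_neg, ← smul_neg]
        exact P.K.smul_mem (zero_le_two (α := ℝ)) hwK)
      rw [two_smul, add_sub_cancel_right] at h2
      rw [zero_sub, inner_neg_right] at h0
      linarith
    refine ⟨fun k hk => ?_, h1⟩
    have := h.2 (-k) (by simpa using hk)
    rw [inner_sub_right, h1, inner_neg_right] at this
    linarith
  · rintro ⟨h, h0⟩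
    refine ⟨hw, fun z hz => ?_⟩
    have := h (-z) hz
    rw [inner_neg_right] at this
    rw [inner_sub_right, h0]
    linarith

theorem isPolyhedralSet_neg_cone (hK : P.K.DualFG (innerₗ (EuclideanSpace ℝ (Fin m)))) :
    IsPolyhedralSet (-(P.K : Set (EuclideanSpace ℝ (Fin m)))) := by
  obtain ⟨s, hs⟩ := hK
  refine .of_finite (ι := s) (fun a => (a : EuclideanSpace ℝ (Fin m))) (fun _ => 0) fun x => ?_
  rw [Set.mem_neg, SetLike.mem_coe, ← hs, PointedCone.mem_dual]
  simp

/-- `w` is a normal vector of the dual cone at `l` only if `l` is one of `-K` at `w`; this uses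
that `K` is its own bidual. -/
theorem mem_normalCone_neg_cone_of_mem_normalCone_dualCone
    (hK : P.K.DualFG (innerₗ (EuclideanSpace ℝ (Fin m)))) {w l : EuclideanSpace ℝ (Fin m)}
    (h : w ∈ normalCone P.dualCone l) :
    l ∈ normalCone (-(P.K : Set (EuclideanSpace ℝ (Fin m)))) w := by
  have hl : ∀ k ∈ P.K, 0 ≤ inner ℝ l k := P.mem_dualCone.1 h.1
  have h0 : inner ℝ w l = 0 := by
    have h0 := h.2 0 (P.mem_dualCone.2 fun k _ => by simp)
    have h2 := h.2 ((2 : ℝ) • l) (P.mem_dualCone.2 fun k hk => by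
      rw [real_inner_smul_left]
      exact mul_nonneg two_pos.le (hl k hk))
    rw [two_smul, add_sub_cancel_right] at h2
    rw [zero_sub, inner_neg_right] at h0
    linarith
  have hw : w ∈ -(P.K : Set (EuclideanSpace ℝ (Fin m))) := by
    obtain ⟨s, hs⟩ := hK
    rw [Set.mem_neg, SetLike.mem_coe, ← hs, PointedCone.mem_dual]
    intro a ha
    have := h.2 a (P.mem_dualCone.2 fun k hk => by
      rw [← hs, PointedCone.mem_dual] at hk
      exact hk ha)
    rw [inner_sub_right, h0, real_inner_comm] at this
    rw [innerₗ_apply_apply, inner_neg_right]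
    linarith
  exact (P.mem_normalCone_neg_cone hw).2 ⟨h.1, by rwa [real_inner_comm]⟩

theorem mem_multipliers_iff {x : EuclideanSpace ℝ (Fin n)} (hx : x ∈ P.feasible)
    {y : Multiplier p m} : y ∈ P.multipliers x ↔
      y.snd ∈ normalCone (-(P.K : Set (EuclideanSpace ℝ (Fin m)))) (P.g x) ∧
        -P.gradLagrangian x y ∈ normalCone P.X x := by
  rw [P.mem_normalCone_neg_cone hx.2.2]
  exact ⟨fun h => ⟨⟨h.1, h.2.2⟩, h.2.1⟩, fun h => ⟨h.1.1, h.2, h.1.2⟩⟩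

/-- The three terms of the residual, with the two distances attained. -/
theorem exists_of_residual (hK : P.K.DualFG (innerₗ (EuclideanSpace ℝ (Fin m))))
    {x : EuclideanSpace ℝ (Fin n)} {y : Multiplier p m} (hx : x ∈ P.X) (hy : y.snd ∈ P.dualCone) :
    ∃ s ∈ normalCone P.X x, ∃ w, y.snd ∈ normalCone (-(P.K : Set (EuclideanSpace ℝ (Fin m)))) w ∧
      ‖P.gradLagrangian x y + s‖ ≤ P.residual x y ∧ ‖P.h x‖ ≤ P.residual x y ∧
        ‖w - P.g x‖ ≤ P.residual x y := by
  obtain ⟨s, hs, h1⟩ := exists_mem_norm_add_eq_infDist (isClosed_normalCone P.X x)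
    ⟨0, zero_mem_normalCone hx⟩ (P.gradLagrangian x y)
  obtain ⟨w, hw, h2⟩ := exists_mem_norm_add_eq_infDist (isClosed_normalCone P.dualCone y.snd)
    ⟨0, zero_mem_normalCone hy⟩ (-P.g x)
  refine ⟨s, hs, w, P.mem_normalCone_neg_cone_of_mem_normalCone_dualCone hK hw, ?_⟩
  rw [sub_eq_neg_add, residual, ← h1, ← h2]
  refine ⟨?_, ?_, ?_⟩ <;>
    linarith [norm_nonneg (P.gradLagrangian x y + s), norm_nonneg (P.h x), norm_nonneg (-P.g x + w)]

theorem residual_nonneg (x : EuclideanSpace ℝ (Fin n)) (y : Multiplier p m) :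
    0 ≤ P.residual x y :=
  add_nonneg (add_nonneg Metric.infDist_nonneg (norm_nonneg _)) Metric.infDist_nonneg

theorem residual_eq_zero {x : EuclideanSpace ℝ (Fin n)} {y : Multiplier p m}
    (hx : x ∈ P.feasible) (hy : y ∈ P.multipliers x) : P.residual x y = 0 := by
  have h1 : (0 : EuclideanSpace ℝ (Fin n)) ∈
      {P.gradLagrangian x y} + normalCone P.X x :=
    Set.mem_add.2 ⟨_, rfl, _, hy.2.1, add_neg_cancel _⟩
  have h2 : (0 : EuclideanSpace ℝ (Fin m)) ∈ {-P.g x} + normalCone P.dualCone y.snd := by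
    refine Set.mem_add.2 ⟨_, rfl, P.g x, ⟨hy.1, fun l hl => ?_⟩, neg_add_cancel _⟩
    have := P.mem_dualCone.1 hl _ hx.2.2
    rw [inner_neg_right] at this
    rw [inner_sub_right, real_inner_comm, real_inner_comm y.snd, hy.2.2]
    linarith
  rw [residual, Metric.infDist_zero_of_mem h1, Metric.infDist_zero_of_mem h2, hx.2.1]
  simp

/-! ### Derivatives of the Lagrangian -/

/-- The operator `(v, λ) ↦ ∇h(x)ᵀ v + ∇g(x)ᵀ λ`, the part of `∇ₓΦ(x, v, λ)` which is linear in the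
multiplier. -/
noncomputable def jacobianTranspose (x : EuclideanSpace ℝ (Fin n)) :
    Multiplier p m →L[ℝ] EuclideanSpace ℝ (Fin n) :=
  (ContinuousLinearMap.adjoint (fderiv ℝ P.h x)).comp
      (WithLp.fstL 2 ℝ (EuclideanSpace ℝ (Fin p)) (EuclideanSpace ℝ (Fin m))) +
    (ContinuousLinearMap.adjoint (fderiv ℝ P.g x)).comp
      (WithLp.sndL 2 ℝ (EuclideanSpace ℝ (Fin p)) (EuclideanSpace ℝ (Fin m)))

theorem jacobianTranspose_apply (x : EuclideanSpace ℝ (Fin n)) (y : Multiplier p m) :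
    P.jacobianTranspose x y = ContinuousLinearMap.adjoint (fderiv ℝ P.h x) y.fst +
      ContinuousLinearMap.adjoint (fderiv ℝ P.g x) y.snd := rfl

theorem inner_jacobianTranspose (x d : EuclideanSpace ℝ (Fin n)) (y : Multiplier p m) :
    inner ℝ (P.jacobianTranspose x y) d =
      inner ℝ y.fst (fderiv ℝ P.h x d) + inner ℝ y.snd (fderiv ℝ P.g x d) := by
  rw [jacobianTranspose_apply, inner_add_left, ContinuousLinearMap.adjoint_inner_left,
    ContinuousLinearMap.adjoint_inner_left]

variable {P} {xbar : EuclideanSpace ℝ (Fin n)}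

theorem gradLagrangian_eq {x : EuclideanSpace ℝ (Fin n)} (hf : DifferentiableAt ℝ P.f x)
    (hh : DifferentiableAt ℝ P.h x) (hg : DifferentiableAt ℝ P.g x) (y : Multiplier p m) :
    P.gradLagrangian x y = gradient P.f x + P.jacobianTranspose x y := by
  refine HasGradientAt.gradient ?_
  rw [hasGradientAt_iff_hasFDerivAt]
  have h1 := (innerSL ℝ y.fst).hasFDerivAt.comp x hh.hasFDerivAt
  have h2 := (innerSL ℝ y.snd).hasFDerivAt.comp x hg.hasFDerivAt
  refine ((hf.hasGradientAt.hasFDerivAt.add h1).add h2).congr_fderiv ?_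
  ext d
  simp [inner_jacobianTranspose, add_assoc]

theorem eventually_gradLagrangian_eq (hf : ContDiffAt ℝ 2 P.f xbar) (hh : ContDiffAt ℝ 2 P.h xbar)
    (hg : ContDiffAt ℝ 2 P.g xbar) : ∀ᶠ x in 𝓝 xbar, ∀ y,
      P.gradLagrangian x y = gradient P.f x + P.jacobianTranspose x y := by
  filter_upwards [hf.eventually (by simp), hh.eventually (by simp), hg.eventually (by simp)]
    with x h1 h2 h3 y
  exact gradLagrangian_eq (h1.differentiableAt (by simp)) (h2.differentiableAt (by simp))
    (h3.differentiableAt (by simp)) y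

theorem differentiableAt_gradient (hf : ContDiffAt ℝ 2 P.f xbar) :
    DifferentiableAt ℝ (gradient P.f) xbar :=
  isBoundedLinearMap_toDual_symm.differentiableAt.comp xbar
    ((hf.fderiv_right (m := 1) (by norm_num)).differentiableAt (by simp))

theorem differentiableAt_jacobianTranspose (hh : ContDiffAt ℝ 2 P.h xbar)
    (hg : ContDiffAt ℝ 2 P.g xbar) : DifferentiableAt ℝ P.jacobianTranspose xbar := by
  have h1 : DifferentiableAt ℝ (fun x => ContinuousLinearMap.adjoint (fderiv ℝ P.h x)) xbar :=
    isBoundedLinearMap_adjoint.differentiableAt.comp xbar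
      ((hh.fderiv_right (m := 1) (by norm_num)).differentiableAt (by simp))
  have h2 : DifferentiableAt ℝ (fun x => ContinuousLinearMap.adjoint (fderiv ℝ P.g x)) xbar :=
    isBoundedLinearMap_adjoint.differentiableAt.comp xbar
      ((hg.fderiv_right (m := 1) (by norm_num)).differentiableAt (by simp))
  exact (h1.clm_comp (differentiableAt_const _)).add (h2.clm_comp (differentiableAt_const _))

theorem hessLagrangian_apply (hf : ContDiffAt ℝ 2 P.f xbar) (hh : ContDiffAt ℝ 2 P.h xbar)
    (hg : ContDiffAt ℝ 2 P.g xbar) (y : Multiplier p m) (d : EuclideanSpace ℝ (Fin n)) :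
    P.hessLagrangian xbar y d =
      fderiv ℝ (gradient P.f) xbar d + fderiv ℝ P.jacobianTranspose xbar d y := by
  have h : (fun x => P.gradLagrangian x y) =ᶠ[𝓝 xbar]
      fun x => gradient P.f x + P.jacobianTranspose x y :=
    (eventually_gradLagrangian_eq hf hh hg).mono fun x hx => hx y
  have h2 := (differentiableAt_jacobianTranspose hh hg).hasFDerivAt.clm_apply
    (hasFDerivAt_const y xbar)
  rw [hessLagrangian, h.fderiv_eq, ((differentiableAt_gradient hf).hasFDerivAt.fun_add h2).fderiv]
  simp

end ConicProgram

/-! ### The multiplier set -/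

namespace ConicProgram

variable {n p m : ℕ} {P : ConicProgram n p m} {xbar : EuclideanSpace ℝ (Fin n)}

/-- Under the constraint qualification the recession cone of the multiplier set is trivial. -/
theorem eq_zero_of_conicMFCQ (hMFCQ : P.ConicMFCQ xbar) {y : Multiplier p m}
    (hy : y.snd ∈ P.dualCone) (hyg : inner ℝ y.snd (P.g xbar) = 0)
    (hN : -P.jacobianTranspose xbar y ∈ normalCone P.X xbar) : y = 0 := by
  obtain ⟨h1, d, hd, hhd, hint⟩ := hMFCQ
  have hy' := P.mem_dualCone.1 hy
  have hl : y.snd = 0 := by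
    set k := -(P.g xbar + fderiv ℝ P.g xbar d) with hk
    have hint' : k ∈ interior (P.K : Set (EuclideanSpace ℝ (Fin m))) := hint
    have h2 := inner_nonpos_of_mem_posTangentConeAt hN hd
    rw [inner_neg_left, inner_jacobianTranspose, hhd, inner_zero_right, zero_add] at h2
    have h3 : inner ℝ y.snd k ≤ 0 := by
      rw [hk, inner_neg_right, inner_add_right, hyg]
      linarith
    -- `K` contains `k - t • λ` for small `t > 0`
    have hc : Tendsto (fun t : ℝ => k - t • y.snd) (𝓝[>] 0) (𝓝 k) := by
      have : Continuous fun t : ℝ => k - t • y.snd := by fun_prop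
      simpa using (this.tendsto 0).mono_left nhdsWithin_le_nhds
    obtain ⟨t, ht, ht0⟩ := ((hc.eventually (mem_interior_iff_mem_nhds.1 hint')).and
      self_mem_nhdsWithin).exists
    have ht0 : 0 < t := ht0
    have h4 := hy' _ ht
    rw [inner_sub_right, real_inner_smul_right] at h4
    have h5 : inner ℝ y.snd y.snd ≤ 0 := by
      by_contra! h
      nlinarith [mul_pos ht0 h]
    exact real_inner_self_nonpos.1 h5
  have hv := (h1 y.fst _ hN (by rw [jacobianTranspose_apply, hl, map_zero, add_zero,
    add_neg_cancel])).1
  exact WithLp.ofLp_injective 2 (Prod.ext hv hl)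

/-- Multipliers are locally uniformly bounded: otherwise a limit of normalized multipliers would be
a nonzero recession direction of the multiplier set. -/
theorem eventually_multipliers_bounded (hf : ContDiffAt ℝ 2 P.f xbar)
    (hh : ContDiffAt ℝ 2 P.h xbar) (hg : ContDiffAt ℝ 2 P.g xbar) (hX : xbar ∈ P.X)
    (hMFCQ : P.ConicMFCQ xbar) :
    ∃ R : ℝ, ∀ᶠ x in 𝓝 xbar, ∀ y ∈ P.multipliers x, ‖y‖ ≤ R := by
  by_contra! hcon
  have hA := eventually_gradLagrangian_eq hf hh hg
  have hex : ∀ k : ℕ, ∃ x y, dist x xbar < 1 / ((k : ℝ) + 1) ∧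
      (P.gradLagrangian x y = gradient P.f x + P.jacobianTranspose x y) ∧
      y ∈ P.multipliers x ∧ (k : ℝ) + 1 < ‖y‖ := by
    intro k
    have hb : ∀ᶠ x in 𝓝 xbar, dist x xbar < 1 / ((k : ℝ) + 1) :=
      Metric.ball_mem_nhds _ Nat.one_div_pos_of_nat
    obtain ⟨x, ⟨y, hy, hyk⟩, hx, hxA⟩ :=
      ((hcon (k + 1)).and_eventually (hb.and hA)).exists
    exact ⟨x, y, hx, hxA y, hy, hyk⟩
  choose x y hx hgrad hy hyk using hex
  have hpos : ∀ k, 0 < ‖y k‖ := fun k => lt_trans (by positivity) (hyk k)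
  obtain ⟨u, hu, φ, hφ, hlim⟩ := (isCompact_sphere (0 : Multiplier p m) 1).tendsto_subseq
    (x := fun k => ‖y k‖⁻¹ • y k) fun k => by
      simp [norm_smul, (hpos k).ne']
  have hxlim : Tendsto x atTop (𝓝 xbar) := by
    rw [tendsto_iff_dist_tendsto_zero]
    exact squeeze_zero (fun _ => dist_nonneg) (fun k => (hx k).le)
      tendsto_one_div_add_atTop_nhds_zero_nat
  have hinv : Tendsto (fun k => ‖y k‖⁻¹) atTop (𝓝 0) :=
    squeeze_zero (fun k => by positivity)
      (fun k => by
        rw [inv_eq_one_div]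
        exact one_div_le_one_div_of_le (by positivity) (hyk k).le)
      tendsto_one_div_add_atTop_nhds_zero_nat
  have hxφ := hxlim.comp hφ.tendsto_atTop
  have hinvφ := hinv.comp hφ.tendsto_atTop
  have hsnd : Tendsto (fun k => ‖y (φ k)‖⁻¹ • (y (φ k)).snd) atTop (𝓝 u.snd) :=
    (((WithLp.sndL 2 ℝ (EuclideanSpace ℝ (Fin p)) (EuclideanSpace ℝ (Fin m))).continuous.tendsto
      u).comp hlim)
  have hgrad0 := (differentiableAt_gradient hf).continuousAt.tendsto.comp hxφ
  have hJ0 := (differentiableAt_jacobianTranspose hh hg).continuousAt.tendsto.comp hxφ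
  have hg0 := hg.continuousAt.tendsto.comp hxφ
  have hu0 : u = 0 := by
    refine eq_zero_of_conicMFCQ hMFCQ (P.mem_dualCone.2 fun k hk => ?_) ?_ ?_
    · refine ge_of_tendsto (hsnd.inner tendsto_const_nhds) (Eventually.of_forall fun j => ?_)
      rw [real_inner_smul_left]
      exact mul_nonneg (by positivity) (P.mem_dualCone.1 (hy _).1 k hk)
    · refine tendsto_nhds_unique (hsnd.inner hg0) (tendsto_const_nhds.congr fun j => ?_)
      simp [real_inner_smul_left, (hy (φ j)).2.2]
    · refine mem_normalCone_of_tendsto hX hxφ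
        (σ := fun k => ‖y (φ k)‖⁻¹ • -P.gradLagrangian (x (φ k)) (y (φ k))) ?_
        fun k => smul_mem_normalCone (by positivity) (hy _).2.1
      have h := ((hinvφ.smul hgrad0).add (Filter.Tendsto.clm_apply hJ0 hlim)).neg
      rw [zero_smul, zero_add] at h
      refine h.congr fun k => ?_
      simp [hgrad, smul_add]
  simp [hu0] at hu

/-- The multiplier map has closed graph. -/
theorem mem_multipliers_of_tendsto {α : Type*} {l : Filter α} [l.NeBot]
    (hf : ContDiffAt ℝ 2 P.f xbar)
    (hh : ContDiffAt ℝ 2 P.h xbar) (hg : ContDiffAt ℝ 2 P.g xbar) (hX : xbar ∈ P.X)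
    {x : α → EuclideanSpace ℝ (Fin n)} {y : α → Multiplier p m} {ybar : Multiplier p m}
    (hx : Tendsto x l (𝓝 xbar)) (hy : Tendsto y l (𝓝 ybar))
    (h : ∀ k, y k ∈ P.multipliers (x k)) : ybar ∈ P.multipliers xbar := by
  have hsnd : Tendsto (fun k => (y k).snd) l (𝓝 ybar.snd) :=
    ((WithLp.sndL 2 ℝ (EuclideanSpace ℝ (Fin p)) (EuclideanSpace ℝ (Fin m))).continuous.tendsto
      ybar).comp hy
  have hA := eventually_gradLagrangian_eq hf hh hg
  refine ⟨P.mem_dualCone.2 fun k hk => ?_, ?_, ?_⟩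
  · exact ge_of_tendsto (hsnd.inner tendsto_const_nhds)
      (Eventually.of_forall fun j => P.mem_dualCone.1 (h j).1 k hk)
  · refine mem_normalCone_of_tendsto hX hx ?_ fun k => (h k).2.1
    rw [hA.self_of_nhds]
    refine Tendsto.neg (Tendsto.congr' ?_
      (((differentiableAt_gradient hf).continuousAt.tendsto.comp hx).add
      (Filter.Tendsto.clm_apply
        ((differentiableAt_jacobianTranspose hh hg).continuousAt.tendsto.comp hx) hy)))
    filter_upwards [hx.eventually hA] with k hk
    exact (hk _).symm
  · refine tendsto_nhds_unique (hsnd.inner (hg.continuousAt.tendsto.comp hx))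
      (tendsto_const_nhds.congr fun j => ?_)
    exact (h j).2.2.symm

theorem isClosed_multipliers (hf : ContDiffAt ℝ 2 P.f xbar) (hh : ContDiffAt ℝ 2 P.h xbar)
    (hg : ContDiffAt ℝ 2 P.g xbar) (hX : xbar ∈ P.X) : IsClosed (P.multipliers xbar) := by
  refine isClosed_of_closure_subset fun y hy => ?_
  obtain ⟨z, hz, hlim⟩ := mem_closure_iff_seq_limit.1 hy
  exact mem_multipliers_of_tendsto hf hh hg hX tendsto_const_nhds hlim hz

/-- A Hoffman bound for the multiplier set: `P.multipliers xbar` is the set of multipliers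
`(v, λ)` with `λ` in the normal cone of `-K` and `-∇f - ∇hᵀ v - ∇gᵀ λ` in that of `X`. -/
theorem exists_infDist_multipliers_le_of_normal (hPX : IsPolyhedralSet P.X)
    (hK : P.K.DualFG (innerₗ (EuclideanSpace ℝ (Fin m)))) (hxbar : P.IsKKTPoint xbar)
    (hgrad : ∀ y, P.gradLagrangian xbar y = gradient P.f xbar + P.jacobianTranspose xbar y) :
    ∃ C : ℝ, 0 ≤ C ∧ ∀ y : Multiplier p m,
      y.snd ∈ normalCone (-(P.K : Set (EuclideanSpace ℝ (Fin m)))) (P.g xbar) →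
      ∀ s ∈ normalCone P.X xbar,
        Metric.infDist y (P.multipliers xbar) ≤ C * ‖P.gradLagrangian xbar y + s‖ := by
  have h1 := ((P.isPolyhedralSet_neg_cone hK).isPolyhedralSet_normalCone hxbar.1.2.2).preimage 0
    (WithLp.sndL 2 ℝ (EuclideanSpace ℝ (Fin p)) (EuclideanSpace ℝ (Fin m)))
  have h2 := hPX.isPolyhedralSet_normalCone hxbar.1.1
  have hset : P.multipliers xbar =
      {y | y ∈ {y | 0 + WithLp.sndL 2 ℝ (EuclideanSpace ℝ (Fin p)) (EuclideanSpace ℝ (Fin m)) y ∈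
        normalCone (-(P.K : Set (EuclideanSpace ℝ (Fin m)))) (P.g xbar)} ∧
        -gradient P.f xbar + (-P.jacobianTranspose xbar) y ∈ normalCone P.X xbar} := by
    ext y
    rw [P.mem_multipliers_iff hxbar.1, hgrad, neg_add]
    simp
  obtain ⟨C, hC, h⟩ := h1.exists_infDist_le h2 _ _ (hset ▸ hxbar.2)
  refine ⟨C, hC, fun y hy s hs => ?_⟩
  have := h y (by simpa using hy) s hs
  rw [← hset] at this
  refine this.trans_eq ?_
  rw [hgrad, ← norm_neg]
  congr 2
  simp
  abel

/-- The distance of `y` from the multiplier set at `xbar` is at most of the order of `‖x - xbar‖`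
plus the residual at `(x, y)`: the normal vectors at `x` and at `w` which realize the residual are
also normal at `xbar` and at `g xbar`, where the Hoffman bound applies. -/
theorem exists_infDist_multipliers_le (hPX : IsPolyhedralSet P.X)
    (hK : P.K.DualFG (innerₗ (EuclideanSpace ℝ (Fin m)))) (hxbar : P.IsKKTPoint xbar)
    (hf : ContDiffAt ℝ 2 P.f xbar) (hh : ContDiffAt ℝ 2 P.h xbar) (hg : ContDiffAt ℝ 2 P.g xbar)
    {R : ℝ} (hR : 0 ≤ R) :
    ∃ C : ℝ, 0 ≤ C ∧ ∃ ε > 0, ∀ x ∈ P.X, ∀ y : Multiplier p m, y.snd ∈ P.dualCone → ‖y‖ ≤ R →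
      ‖x - xbar‖ ≤ ε → P.residual x y ≤ ε →
      Metric.infDist y (P.multipliers xbar) ≤ C * (‖x - xbar‖ + P.residual x y) := by
  have hA := eventually_gradLagrangian_eq hf hh hg
  obtain ⟨C, hC, hM⟩ := exists_infDist_multipliers_le_of_normal hPX hK hxbar hA.self_of_nhds
  obtain ⟨c₀, hc₀⟩ := (differentiableAt_gradient hf).isBigO_sub.bound
  obtain ⟨c₁, hc₁⟩ := (differentiableAt_jacobianTranspose hh hg).isBigO_sub.bound
  obtain ⟨ε₁, hε₁, hN⟩ := Metric.eventually_nhds_iff.1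
    ((P.isPolyhedralSet_neg_cone hK).eventually_normalCone_subset hxbar.1.2.2)
  have hgc : ∀ᶠ x in 𝓝 xbar, dist (P.g x) (P.g xbar) < ε₁ / 2 :=
    hg.continuousAt.eventually (Metric.ball_mem_nhds _ (half_pos hε₁))
  obtain ⟨ε₂, hε₂, hall⟩ := Metric.eventually_nhds_iff.1
    (hA.and (hc₀.and (hc₁.and ((hPX.eventually_normalCone_subset hxbar.1.1).and hgc))))
  refine ⟨C * (1 + |c₀| + |c₁| * R), by positivity, min (ε₁ / 4) (ε₂ / 2), by positivity,
    fun x hx y hy hyR hxε hrε => ?_⟩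
  obtain ⟨hgrad, h0, h1, hNX, hgx⟩ := hall (y := x) (by
    rw [dist_eq_norm]
    exact (hxε.trans (min_le_right _ _)).trans_lt (by linarith))
  obtain ⟨s, hs, w, hw, hr1, -, hr3⟩ := P.exists_of_residual hK hx hy
  have hwd : dist w (P.g xbar) < ε₁ := by
    have h2 : dist w (P.g x) ≤ ε₁ / 4 := by
      rw [dist_eq_norm]
      exact (hr3.trans hrε).trans (min_le_left _ _)
    linarith [dist_triangle w (P.g x) (P.g xbar)]
  refine (hM y (hN hwd hw) s (hNX hs)).trans ?_
  rw [mul_assoc]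
  refine mul_le_mul_of_nonneg_left ?_ hC
  have hdec : P.gradLagrangian xbar y + s = (P.gradLagrangian x y + s) -
      (gradient P.f x - gradient P.f xbar) -
      (P.jacobianTranspose x - P.jacobianTranspose xbar) y := by
    rw [hA.self_of_nhds, hgrad, sub_apply]
    abel
  have hr0 := P.residual_nonneg x y
  have hx0 := norm_nonneg (x - xbar)
  have h2 : ‖(P.jacobianTranspose x - P.jacobianTranspose xbar) y‖ ≤
      |c₁| * ‖x - xbar‖ * R := by
    refine (ContinuousLinearMap.le_opNorm _ _).trans ?_
    gcongr
    exact h1.trans (by gcongr; exact le_abs_self _)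
  have h3 : ‖gradient P.f x - gradient P.f xbar‖ ≤ |c₀| * ‖x - xbar‖ :=
    h0.trans (by gcongr; exact le_abs_self _)
  rw [hdec]
  refine (norm_sub_le _ _).trans ((add_le_add_left (norm_sub_le _ _) _).trans ?_)
  have h4 : 0 ≤ (|c₀| + |c₁| * R) * P.residual x y := by positivity
  nlinarith

end ConicProgram

/-! ### The second-order system in the limit -/

namespace ConicProgram

variable {n p m : ℕ} {P : ConicProgram n p m} {xbar : EuclideanSpace ℝ (Fin n)}

/-- Critical directions are orthogonal to every multiplier: the two quantities are equal because
`⟪∇f, u⟫ = 0` and `∇h u = 0`, and they have opposite signs. -/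
theorem inner_gradLagrangian_eq_zero
    (hgrad : ∀ y, P.gradLagrangian xbar y = gradient P.f xbar + P.jacobianTranspose xbar y)
    (hx : xbar ∈ P.feasible) {y : Multiplier p m} (hy : y ∈ P.multipliers xbar)
    {u : EuclideanSpace ℝ (Fin n)} (hu : u ∈ P.criticalCone xbar) :
    inner ℝ y.snd (fderiv ℝ P.g xbar u) = 0 ∧ inner ℝ (P.gradLagrangian xbar y) u = 0 := by
  obtain ⟨hu1, hu2, hu3, hu4⟩ := hu
  obtain ⟨hy1, hy2⟩ := (P.mem_multipliers_iff hx).1 hy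
  have h1 := inner_nonpos_of_mem_posTangentConeAt hy1 hu3
  have h2 := inner_nonpos_of_mem_posTangentConeAt hy2 hu1
  have h3 : inner ℝ (P.gradLagrangian xbar y) u = inner ℝ y.snd (fderiv ℝ P.g xbar u) := by
    rw [hgrad, inner_add_left, hu4, inner_jacobianTranspose, hu2, inner_zero_right]
    ring
  rw [inner_neg_left, h3] at h2
  rw [h3]
  exact ⟨by linarith, by linarith⟩

/-- If the KKT conditions hold at `(xₖ, yₖ)` up to an error `o(τₖ)`, where
`xₖ = xbar + τₖ d + o(τₖ)` and `yₖ` has distance `O(τₖ)` from multipliers `ŷₖ` at `xbar`, then `d`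
solves the second-order system at the limit of `yₖ`. The limit `z` of `(yₖ - ŷₖ) / τₖ` enters
through `⟪z.snd, ∇g u⟫`, which is nonpositive for every critical `u`, and zero for `u = d`. -/
theorem solvesSecondOrderSystem_of_tendsto {α : Type*} {l : Filter α} [l.NeBot]
    (hf : ContDiffAt ℝ 2 P.f xbar) (hh : ContDiffAt ℝ 2 P.h xbar) (hg : ContDiffAt ℝ 2 P.g xbar)
    (hxbar : xbar ∈ P.feasible)
    {x s : α → EuclideanSpace ℝ (Fin n)} {y yhat : α → Multiplier p m}
    {w : α → EuclideanSpace ℝ (Fin m)} {τ : α → ℝ}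
    {d : EuclideanSpace ℝ (Fin n)} {ybar z : Multiplier p m}
    (hτ : ∀ k, 0 < τ k) (hτ0 : Tendsto τ l (𝓝 0))
    (hs : ∀ k, s k ∈ normalCone P.X (x k))
    (hs' : ∀ᶠ k in l, s k ∈ normalCone P.X xbar)
    (hw : ∀ k, (y k).snd ∈ normalCone (-(P.K : Set (EuclideanSpace ℝ (Fin m)))) (w k))
    (hw' : ∀ᶠ k in l, (y k).snd ∈ normalCone (-(P.K : Set (EuclideanSpace ℝ (Fin m)))) (P.g xbar))
    (hyhat : ∀ k, yhat k ∈ P.multipliers xbar)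
    (hgrad0 : Tendsto (fun k => (τ k)⁻¹ • (P.gradLagrangian (x k) (y k) + s k)) l (𝓝 0))
    (hh0 : Tendsto (fun k => (τ k)⁻¹ • P.h (x k)) l (𝓝 0))
    (hg0 : Tendsto (fun k => (τ k)⁻¹ • (w k - P.g (x k))) l (𝓝 0))
    (hd : Tendsto (fun k => (τ k)⁻¹ • (x k - xbar)) l (𝓝 d))
    (hy : Tendsto y l (𝓝 ybar))
    (hz : Tendsto (fun k => (τ k)⁻¹ • (y k - yhat k)) l (𝓝 z)) :
    ybar ∈ P.multipliers xbar ∧ P.SolvesSecondOrderSystem xbar ybar d := by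
  have hA := eventually_gradLagrangian_eq hf hh hg
  have hgradbar := hA.self_of_nhds
  have hsmul0 : ∀ {E : Type} [NormedAddCommGroup E] [NormedSpace ℝ E] {v : α → E} {e : E},
      Tendsto (fun k => (τ k)⁻¹ • v k) l (𝓝 e) → Tendsto v l (𝓝 0) := by
    intro E _ _ v e hv
    have := hτ0.smul hv
    rw [zero_smul] at this
    exact this.congr fun k => smul_inv_smul₀ (hτ k).ne' _
  have hx : Tendsto x l (𝓝 xbar) := by
    simpa using (hsmul0 hd).add_const xbar
  have hyhatlim : Tendsto yhat l (𝓝 ybar) := by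
    simpa using hy.sub (hsmul0 hz)
  have hM : ybar ∈ P.multipliers xbar :=
    mem_multipliers_of_tendsto hf hh hg hxbar.1 tendsto_const_nhds hyhatlim hyhat
  have hsnd : ∀ {v : α → Multiplier p m} {e : Multiplier p m}, Tendsto v l (𝓝 e) →
      Tendsto (fun k => (v k).snd) l (𝓝 e.snd) := fun {v e} hv =>
    ((WithLp.sndL 2 ℝ (EuclideanSpace ℝ (Fin p)) (EuclideanSpace ℝ (Fin m))).continuous.tendsto
      e).comp hv
  -- first-order limits of the constraints
  have hhd : fderiv ℝ P.h xbar d = 0 := by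
    refine tendsto_nhds_unique
      ((hh.differentiableAt (by simp)).hasFDerivAt.tendsto_inv_smul_sub hx hd) ?_
    simpa [hxbar.2.1] using hh0
  have hwlim : Tendsto (fun k => (τ k)⁻¹ • (w k - P.g xbar)) l (𝓝 (fderiv ℝ P.g xbar d)) := by
    have := hg0.add ((hg.differentiableAt (by simp)).hasFDerivAt.tendsto_inv_smul_sub hx hd)
    rw [zero_add] at this
    refine this.congr fun k => ?_
    rw [← smul_add, sub_add_sub_cancel]
  have hdT : d ∈ posTangentConeAt P.X xbar :=
    mem_posTangentConeAt_of_tendsto hτ hτ0 (fun k => (hs k).1) hd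
  have hgT : fderiv ℝ P.g xbar d ∈
      posTangentConeAt (-(P.K : Set (EuclideanSpace ℝ (Fin m)))) (P.g xbar) :=
    mem_posTangentConeAt_of_tendsto hτ hτ0 (fun k => (hw k).1) hwlim
  -- limits of the normal vectors and of their difference quotients
  have hAx : Tendsto (fun k => gradient P.f (x k)) l (𝓝 (gradient P.f xbar)) :=
    (differentiableAt_gradient hf).continuousAt.tendsto.comp hx
  have hJx : Tendsto (fun k => P.jacobianTranspose (x k)) l (𝓝 (P.jacobianTranspose xbar)) :=
    (differentiableAt_jacobianTranspose hh hg).continuousAt.tendsto.comp hx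
  have hslim : Tendsto s l (𝓝 (-P.gradLagrangian xbar ybar)) := by
    have := (hsmul0 hgrad0).sub (hAx.add (Filter.Tendsto.clm_apply hJx hy))
    rw [zero_sub, ← hgradbar] at this
    refine this.congr' ?_
    filter_upwards [hx.eventually hA] with k hk
    rw [hk]
    abel
  have hσ : Tendsto (fun k => (τ k)⁻¹ • (s k + P.gradLagrangian xbar (yhat k))) l
      (𝓝 (-(P.hessLagrangian xbar ybar d + P.jacobianTranspose xbar z))) := by
    have h1 := (differentiableAt_gradient hf).hasFDerivAt.tendsto_inv_smul_sub hx hd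
    have h2 := Filter.Tendsto.clm_apply
      ((differentiableAt_jacobianTranspose hh hg).hasFDerivAt.tendsto_inv_smul_sub hx hd) hy
    have h3 := ((P.jacobianTranspose xbar).continuous.tendsto z).comp hz
    have h4 := hgrad0.sub ((h1.add h2).add h3)
    rw [zero_sub, ← hessLagrangian_apply hf hh hg] at h4
    refine h4.congr' ?_
    filter_upwards [hx.eventually hA] with k hk
    simp only [Function.comp_apply, hk, hgradbar, map_smul, map_sub, smul_apply, sub_apply,
      ← smul_add, ← smul_sub]
    congr 1
    abel
  have hsd : ∀ k, 0 ≤ inner ℝ (s k) ((τ k)⁻¹ • (x k - xbar)) := fun k => by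
    have h := (hs k).2 xbar hxbar.1
    rw [← neg_sub, inner_neg_right] at h
    rw [real_inner_smul_right]
    exact mul_nonneg (inv_nonneg.2 (hτ k).le) (by linarith)
  have hyw : ∀ k, 0 ≤ inner ℝ (y k).snd ((τ k)⁻¹ • (w k - P.g xbar)) := fun k => by
    have h := (hw k).2 (P.g xbar) hxbar.2.2
    rw [← neg_sub, inner_neg_right] at h
    rw [real_inner_smul_right]
    exact mul_nonneg (inv_nonneg.2 (hτ k).le) (by linarith)
  obtain ⟨hM1, hM2⟩ := (P.mem_multipliers_iff hxbar).1 hM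
  have hfd : inner ℝ (gradient P.f xbar) d = 0 := by
    have h1 := inner_nonpos_of_mem_posTangentConeAt hM2 hdT
    have h2 := ge_of_tendsto (hslim.inner hd) (Eventually.of_forall hsd)
    have h3 := inner_nonpos_of_mem_posTangentConeAt hM1 hgT
    have h4 := ge_of_tendsto ((hsnd hy).inner hwlim) (Eventually.of_forall hyw)
    rw [inner_neg_left, hgradbar, inner_add_left, inner_jacobianTranspose, hhd,
      inner_zero_right] at h1 h2
    linarith
  have hdC : d ∈ P.criticalCone xbar := ⟨hdT, hhd, hgT, hfd⟩
  have hJ : ∀ u ∈ P.criticalCone xbar,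
      inner ℝ (P.jacobianTranspose xbar z) u = inner ℝ z.snd (fderiv ℝ P.g xbar u) := by
    intro u hu
    rw [inner_jacobianTranspose, hu.2.1, inner_zero_right, zero_add]
  -- the Hessian maps `d` into the dual of the critical cone
  have hdual : ∀ u ∈ P.criticalCone xbar, 0 ≤ inner ℝ (P.hessLagrangian xbar ybar d) u := by
    intro u hu
    have h1 : inner ℝ (-(P.hessLagrangian xbar ybar d + P.jacobianTranspose xbar z)) u ≤ 0 := by
      refine le_of_tendsto (hσ.inner tendsto_const_nhds) ?_
      filter_upwards [hs'] with k hk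
      rw [real_inner_smul_left, inner_add_left,
        (inner_gradLagrangian_eq_zero hgradbar hxbar (hyhat k) hu).2, add_zero]
      exact mul_nonpos_of_nonneg_of_nonpos (inv_nonneg.2 (hτ k).le)
        (inner_nonpos_of_mem_posTangentConeAt hk hu.1)
    have h2 : inner ℝ z.snd (fderiv ℝ P.g xbar u) ≤ 0 := by
      refine le_of_tendsto ((hsnd hz).inner tendsto_const_nhds) ?_
      filter_upwards [hw'] with k hk
      rw [WithLp.smul_snd, WithLp.sub_snd, real_inner_smul_left, inner_sub_left,
        (inner_gradLagrangian_eq_zero hgradbar hxbar (hyhat k) hu).1, sub_zero]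
      exact mul_nonpos_of_nonneg_of_nonpos (inv_nonneg.2 (hτ k).le)
        (inner_nonpos_of_mem_posTangentConeAt hk hu.2.2.1)
    rw [inner_neg_left, inner_add_left, hJ u hu] at h1
    linarith
  refine ⟨hM, hdC, ?_, fun u hu => by simpa [real_inner_comm] using hdual u hu⟩
  -- monotonicity of the normal cone maps of `X` and of `-K` gives the reverse inequality for `d`
  have h1 : 0 ≤ inner ℝ (-(P.hessLagrangian xbar ybar d + P.jacobianTranspose xbar z)) d := by
    refine ge_of_tendsto (hσ.inner hd) (Eventually.of_forall fun k => ?_)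
    rw [real_inner_smul_left, inner_add_left]
    refine mul_nonneg (inv_nonneg.2 (hτ k).le) (add_nonneg (hsd k) ?_)
    have h := (hyhat k).2.1.2 (x k) (hs k).1
    rw [inner_neg_left] at h
    rw [real_inner_smul_right]
    exact mul_nonneg (inv_nonneg.2 (hτ k).le) (by linarith)
  have h2 : 0 ≤ inner ℝ z.snd (fderiv ℝ P.g xbar d) := by
    refine ge_of_tendsto ((hsnd hz).inner hwlim) (Eventually.of_forall fun k => ?_)
    rw [WithLp.smul_snd, WithLp.sub_snd, real_inner_smul_left, inner_sub_left]
    refine mul_nonneg (inv_nonneg.2 (hτ k).le) (sub_nonneg.2 (le_trans ?_ (hyw k)))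
    rw [real_inner_smul_right]
    exact mul_nonpos_of_nonneg_of_nonpos (inv_nonneg.2 (hτ k).le)
      (((P.mem_multipliers_iff hxbar).1 (hyhat k)).1.2 _ (hw k).1)
  rw [inner_neg_left, inner_add_left, hJ d hdC] at h1
  rw [real_inner_comm]
  exact le_antisymm (by linarith) (hdual d hdC)

end ConicProgram

/-! ### The error bound -/

namespace ConicProgram

variable {n p m : ℕ} {P : ConicProgram n p m} {xbar : EuclideanSpace ℝ (Fin n)}

/-- The estimate of the primal error by the residual. A failure yields sequences to which
`solvesSecondOrderSystem_of_tendsto` applies with a unit vector `d`. -/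
theorem exists_norm_sub_le_residual (hPX : IsPolyhedralSet P.X)
    (hK : P.K.DualFG (innerₗ (EuclideanSpace ℝ (Fin m)))) (hxbar : P.IsKKTPoint xbar)
    (hf : ContDiffAt ℝ 2 P.f xbar) (hh : ContDiffAt ℝ 2 P.h xbar) (hg : ContDiffAt ℝ 2 P.g xbar)
    {R : ℝ} (hR : ∀ y, Metric.infDist y (P.multipliers xbar) ≤ 1 → ‖y‖ ≤ R)
    (hSOC : ∀ y ∈ P.multipliers xbar, ∀ d, P.SolvesSecondOrderSystem xbar y d → d = 0) :
    ∃ c > 0, ∃ ε > 0, ∀ x ∈ P.X, ∀ y : Multiplier p m, y.snd ∈ P.dualCone →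
      ‖x - xbar‖ + Metric.infDist y (P.multipliers xbar) ≤ ε →
        ‖x - xbar‖ ≤ c * P.residual x y := by
  by_contra! hcon
  have hex : ∀ k : ℕ, ∃ x ∈ P.X, ∃ y : Multiplier p m, y.snd ∈ P.dualCone ∧
      ‖x - xbar‖ + Metric.infDist y (P.multipliers xbar) ≤ 1 / ((k : ℝ) + 1) ∧
      ((k : ℝ) + 1) * P.residual x y < ‖x - xbar‖ := fun k =>
    hcon (k + 1) (by positivity) (1 / ((k : ℝ) + 1)) (by positivity)
  choose x hxX y hy ht hr using hex
  have hR0 : 0 ≤ R := by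
    obtain ⟨y₀, hy₀⟩ := hxbar.2
    exact (norm_nonneg y₀).trans (hR y₀ (by rw [Metric.infDist_zero_of_mem hy₀]; exact zero_le_one))
  have hτ : ∀ k, 0 < ‖x k - xbar‖ := fun k =>
    (mul_nonneg (by positivity) (P.residual_nonneg _ _)).trans_lt (hr k)
  have hle : ∀ k : ℕ, 1 / ((k : ℝ) + 1) ≤ 1 := fun k => by
    rw [div_le_one (by positivity)]
    linarith [Nat.cast_nonneg (α := ℝ) k]
  have hxle : ∀ k, ‖x k - xbar‖ ≤ 1 / ((k : ℝ) + 1) := fun k => by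
    linarith [ht k, Metric.infDist_nonneg (x := y k) (s := P.multipliers xbar)]
  have hτ0 : Tendsto (fun k => ‖x k - xbar‖) atTop (𝓝 0) :=
    squeeze_zero (fun _ => norm_nonneg _) hxle tendsto_one_div_add_atTop_nhds_zero_nat
  have hx : Tendsto x atTop (𝓝 xbar) := tendsto_iff_norm_sub_tendsto_zero.2 hτ0
  have hyR : ∀ k, ‖y k‖ ≤ R := fun k => hR _ <| by
    linarith [ht k, hle k, norm_nonneg (x k - xbar)]
  have hrk : ∀ k, ‖x k - xbar‖⁻¹ * P.residual (x k) (y k) ≤ 1 / ((k : ℝ) + 1) := fun k => by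
    rw [inv_mul_le_iff₀ (hτ k), mul_one_div, le_div_iff₀ (by positivity), mul_comm]
    exact (hr k).le
  have hr1 : ∀ k, P.residual (x k) (y k) ≤ ‖x k - xbar‖ := fun k => by
    have := (hrk k).trans (hle k)
    rwa [inv_mul_le_iff₀ (hτ k), mul_one] at this
  choose s hs w hw hgrad hh0 hg0 using fun k => P.exists_of_residual hK (hxX k) (hy k)
  have hsmall : ∀ {E : Type} [NormedAddCommGroup E] [NormedSpace ℝ E] {v : ℕ → E},
      (∀ k, ‖v k‖ ≤ P.residual (x k) (y k)) →
      Tendsto (fun k => ‖x k - xbar‖⁻¹ • v k) atTop (𝓝 0) := by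
    intro E _ _ v hv
    refine squeeze_zero_norm (fun k => ?_) tendsto_one_div_add_atTop_nhds_zero_nat
    rw [norm_smul, norm_inv, norm_norm]
    exact (mul_le_mul_of_nonneg_left (hv k) (by positivity)).trans (hrk k)
  have hwlim : Tendsto w atTop (𝓝 (P.g xbar)) := by
    have h1 : Tendsto (fun k => w k - P.g (x k)) atTop (𝓝 0) :=
      squeeze_zero_norm (fun k => (hg0 k).trans (hr1 k)) hτ0
    simpa using h1.add (hg.continuousAt.tendsto.comp hx)
  have hs' := hx.eventually (hPX.eventually_normalCone_subset hxbar.1.1)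
  have hw' := hwlim.eventually
    ((P.isPolyhedralSet_neg_cone hK).eventually_normalCone_subset hxbar.1.2.2)
  choose yhat hyhat hdist using fun k =>
    (isClosed_multipliers hf hh hg hxbar.1.1).exists_infDist_eq_dist hxbar.2 (y k)
  obtain ⟨C, hC, ε, hε, hest⟩ := exists_infDist_multipliers_le hPX hK hxbar hf hh hg hR0
  have hbdd : ∀ᶠ k in atTop, (‖x k - xbar‖⁻¹ • (x k - xbar), y k,
      ‖x k - xbar‖⁻¹ • (y k - yhat k)) ∈ Metric.closedBall (0 : EuclideanSpace ℝ (Fin n)) 1 ×ˢ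
        Metric.closedBall (0 : Multiplier p m) R ×ˢ
          Metric.closedBall (0 : Multiplier p m) (C * 2) := by
    filter_upwards [hτ0.eventually (gt_mem_nhds hε)] with k hk
    simp only [Set.mem_prod, mem_closedBall_zero_iff, norm_smul, norm_inv, norm_norm]
    refine ⟨(inv_mul_cancel₀ (hτ k).ne').le, hyR k, ?_⟩
    rw [inv_mul_le_iff₀ (hτ k), ← dist_eq_norm, ← hdist]
    refine (hest _ (hxX k) _ (hy k) (hyR k) hk.le ((hr1 k).trans hk.le)).trans ?_
    nlinarith [mul_le_mul_of_nonneg_left (hr1 k) hC]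
  obtain ⟨⟨d, ybar, z⟩, -, φ, hφ, hlim⟩ := ((isCompact_closedBall _ _).prod
    ((isCompact_closedBall _ _).prod (isCompact_closedBall _ _))).tendsto_subseq' hbdd.frequently
  have hφ' := hφ.tendsto_atTop
  have hd := hlim.fst_nhds
  have hyl := hlim.snd_nhds.fst_nhds
  have hzl := hlim.snd_nhds.snd_nhds
  obtain ⟨hM, hsol⟩ := solvesSecondOrderSystem_of_tendsto hf hh hg hxbar.1
    (fun k => hτ (φ k)) (hτ0.comp hφ') (fun k => hs (φ k))
    ((hφ'.eventually hs').mono fun k hk => hk (hs _)) (fun k => hw (φ k))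
    ((hφ'.eventually hw').mono fun k hk => hk (hw _)) (fun k => hyhat (φ k))
    ((hsmall hgrad).comp hφ') ((hsmall hh0).comp hφ') ((hsmall hg0).comp hφ') hd hyl hzl
  have hd1 : ‖d‖ = 1 := by
    refine tendsto_nhds_unique hd.norm (tendsto_const_nhds.congr fun k => ?_)
    simp [norm_smul, (hτ (φ k)).ne']
  rw [hSOC ybar hM d hsol, norm_zero] at hd1
  exact zero_ne_one hd1

/-- Multipliers at points near `xbar` are close to the multiplier set at `xbar`. -/
theorem eventually_infDist_multipliers_le (hf : ContDiffAt ℝ 2 P.f xbar)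
    (hh : ContDiffAt ℝ 2 P.h xbar) (hg : ContDiffAt ℝ 2 P.g xbar) (hX : xbar ∈ P.X)
    (hMFCQ : P.ConicMFCQ xbar) {ε : ℝ} (hε : 0 < ε) :
    ∀ᶠ x in 𝓝 xbar, ∀ y ∈ P.multipliers x, Metric.infDist y (P.multipliers xbar) ≤ ε := by
  obtain ⟨R, hR⟩ := eventually_multipliers_bounded hf hh hg hX hMFCQ
  by_contra! hcon
  obtain ⟨x, hx, hxy⟩ := exists_seq_forall_of_frequently (hcon.and_eventually hR)
  choose y hy hyε using fun k => (hxy k).1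
  obtain ⟨ybar, -, φ, hφ, hlim⟩ := (isCompact_closedBall (0 : Multiplier p m) R).tendsto_subseq
    (x := y) fun k => mem_closedBall_zero_iff.2 ((hxy k).2 _ (hy k))
  have hM := mem_multipliers_of_tendsto hf hh hg hX (hx.comp hφ.tendsto_atTop) hlim
    fun k => hy (φ k)
  have h0 := ((Metric.continuous_infDist_pt (P.multipliers xbar)).tendsto ybar).comp hlim
  rw [Metric.infDist_zero_of_mem hM] at h0
  exact hε.not_ge (ge_of_tendsto h0 (Eventually.of_forall fun k => (hyε (φ k)).le))

end ConicProgram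

theorem mainTheorem2 {n p m : ℕ} (P : ConicProgram n p m)
    (hX : IsPolyhedralSet P.X)
    (hK : P.K.DualFG (innerₗ (EuclideanSpace ℝ (Fin m))))
    (xbar : EuclideanSpace ℝ (Fin n)) (hxbar : P.IsKKTPoint xbar)
    (hf : ContDiffAt ℝ 2 P.f xbar) (hh : ContDiffAt ℝ 2 P.h xbar) (hg : ContDiffAt ℝ 2 P.g xbar)
    (hMFCQ : P.ConicMFCQ xbar) :
    Bornology.IsBounded (P.multipliers xbar) ∧
    ((∀ y ∈ P.multipliers xbar, ∀ d, P.SolvesSecondOrderSystem xbar y d → d = 0) →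
      (∀ᶠ x in 𝓝[≠] xbar, ¬ P.IsKKTPoint x) ∧
      ∃ c > 0, ∃ ε > 0, ∀ (x : EuclideanSpace ℝ (Fin n)) (v : EuclideanSpace ℝ (Fin p))
        (l : EuclideanSpace ℝ (Fin m)), x ∈ P.X → l ∈ P.dualCone →
        ‖x - xbar‖ + Metric.infDist (WithLp.toLp 2 (v, l)) (P.multipliers xbar) ≤ ε →
        ‖x - xbar‖ + Metric.infDist (WithLp.toLp 2 (v, l)) (P.multipliers xbar) ≤
          c * P.residual x (WithLp.toLp 2 (v, l))) := by
  obtain ⟨R, hR⟩ := ConicProgram.eventually_multipliers_bounded hf hh hg hxbar.1.1 hMFCQ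
  have hRbar := hR.self_of_nhds
  refine ⟨isBounded_iff_forall_norm_le.2 ⟨R, hRbar⟩, fun hSOC => ?_⟩
  have hR1 : ∀ y, Metric.infDist y (P.multipliers xbar) ≤ 1 → ‖y‖ ≤ R + 1 := by
    intro y hy
    obtain ⟨y₀, hy₀, h⟩ := (ConicProgram.isClosed_multipliers hf hh hg
      hxbar.1.1).exists_infDist_eq_dist hxbar.2 y
    rw [h, dist_eq_norm] at hy
    linarith [norm_le_norm_add_norm_sub y₀ y, norm_sub_rev y y₀, hRbar y₀ hy₀]
  have hR0 : 0 ≤ R + 1 := by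
    obtain ⟨y₀, hy₀⟩ := hxbar.2
    linarith [norm_nonneg y₀, hRbar y₀ hy₀]
  obtain ⟨c, hc, ε, hε, hbound⟩ :=
    ConicProgram.exists_norm_sub_le_residual hX hK hxbar hf hh hg hR1 hSOC
  constructor
  · rw [eventually_nhdsWithin_iff]
    have hdist := ConicProgram.eventually_infDist_multipliers_le hf hh hg hxbar.1.1 hMFCQ
      (half_pos hε)
    filter_upwards [hdist, Metric.closedBall_mem_nhds xbar (half_pos hε)] with x hx hxε hne hKKT
    obtain ⟨y, hy⟩ := hKKT.2
    rw [Metric.mem_closedBall, dist_eq_norm] at hxε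
    have h := hbound x hKKT.1.1 y hy.1 (by linarith [hx y hy])
    rw [P.residual_eq_zero hKKT.1 hy, mul_zero, norm_le_zero_iff, sub_eq_zero] at h
    exact hne h
  · obtain ⟨C, hC, ε', hε', hest⟩ :=
      ConicProgram.exists_infDist_multipliers_le hX hK hxbar hf hh hg hR0
    refine ⟨1 + c + C * (c + 1), by positivity, min ε (min ε' 1), by positivity,
      fun x v l hx hl ht => ?_⟩
    set y : ConicProgram.Multiplier p m := WithLp.toLp 2 (v, l)
    have hr0 := P.residual_nonneg x y
    have hx0 := norm_nonneg (x - xbar)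
    have hd0 := Metric.infDist_nonneg (x := y) (s := P.multipliers xbar)
    have ht1 := ht.trans (min_le_left _ _)
    have ht2 := ht.trans ((min_le_right _ _).trans (min_le_left _ _))
    have ht3 := ht.trans ((min_le_right _ _).trans (min_le_right _ _))
    have hxr := hbound x hx y hl ht1
    -- If the residual exceeds `ε'`, it exceeds the left-hand side, which is at most `ε'`.
    rcases le_or_gt (P.residual x y) ε' with hr | hr
    · have h1 := hest x hx y hl (hR1 y (by linarith)) (by linarith) hr
      have h2 : C * (‖x - xbar‖ + P.residual x y) ≤ C * (c * P.residual x y + P.residual x y) := by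
        gcongr
      linarith
    · have h1 : 0 ≤ (c + C * (c + 1)) * P.residual x y := by positivity
      linarith
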